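/- For an integer $N\ge 2$ and real numbers $\theta_j$, define the zonal equal area configuration $\omega_N\subset\mathbb S^2=\{x\in\mathbb R^3:|x|=1\}$ as follows. Write $(\phi,\theta)$ for the point $(\sin\phi\cos\theta,\sin\phi\sin\theta,\cos\phi)$ of $\mathbb S^2$ and $\mathrm{round}(x)=\lfloor x+\tfrac12\rfloor$. Let $$\phi_c=\arccos\Bigl(1-\frac2N\Bigr),\qquad \delta_I=\sqrt{4\pi/N},\qquad n_I=\frac{\pi-2\phi_c}{\delta_I},$$ let $n=0$ if $N=2$ and $n=\max\{1,\mathrm{round}(n_I)\}$ otherwise, and, if $n\ge 1$, let $\delta_F=(\pi-2\phi_c)/n$. For $2\le j\le n+1$ put $$A_j=2\pi\bigl(\cos(\phi_c+(j-2)\delta_F)-\cos(\phi_c+(j-1)\delta_F)\bigr),\qquad y_{j,I}=\frac{N A_j}{4\pi}.$$ Put $y_1=y_{n+2}=1$, $a_1=0$ and, for $2\le j\le n+1$, $$y_j=\mathrm{round}(y_{j,I}+a_{j-1}),\qquad a_j=\sum_{k=2}^{j}(y_{k,I}-y_k).$$ Let $\phi_0=0$, $\phi_{n+2}=\pi$ and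 $\phi_j=\arccos\bigl(1-\frac2N\sum_{k=1}^j y_k\bigr)$ for $1\le j\le n+1$. This partitions the sphere, up to boundaries, into $N$ cells of equal area: the polar caps $\{\phi\le\phi_1\}$ and $\{\phi\ge\phi_{n+1}\}$, and, for $2\le j\le n+1$ and $0\le k<y_j$, the cells $$\Bigl\{(\phi,\theta):\ \phi_{j-1}\le\phi\le\phi_j,\ \ \theta_j+\tfrac{2\pi k}{y_j}\le\theta\le\theta_j+\tfrac{2\pi(k+1)}{y_j}\Bigr\}.$$ The configuration $\omega_N$ is the set of centers of these cells: the two poles, and the points $\bigl(\tfrac{\phi_{j-1}+\phi_j}{2},\,\theta_j+\tfrac{2\pi(k+1/2)}{y_j}\bigr)$ for $2\le j\le n+1$ and $0\le k<y_j$. The starting angles $\theta_j=\theta_j^{(N)}$ may be chosen arbitrarily for each $N$ and $j$. **Proposition.** For every choice of the starting angles the following hold. 1. $|\omega_N|=N$ for all $N\ge 2$, and the sequence $\{\omega_N\}$ is equidistributed: for every continuous $f:\mathbb S^2\to\mathbb R$, $$\lim_{N\to\infty}\frac1N\sum_{x\in\omega_N}f(x)=\int_{\mathbb S^2}f\,d\sigma,$$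 where $\sigma$ is the normalized surface area measure on $\mathbb S^2$. 2. The sequence is quasi-uniform: the mesh ratios $\gamma(\omega_N)=\eta(\omega_N)/\delta(\omega_N)$, $N\ge2$, are bounded, where $\eta(\omega_N)=\max_{y\in\mathbb S^2}\min_{x\in\omega_N}|x-y|$ is the covering radius and $\delta(\omega_N)=\min_{x\ne y\in\omega_N}|x-y|$ is the separation. 3. For all $N\ge 2$, $\eta(\omega_N)\le 3.5/\sqrt N$. -/

import Mathlib

namespace ZonalEqualArea

noncomputable section

open MeasureTheory Filter Topology

/-- The unit sphere `S²` in Euclidean 3-space; its `dist` is the chordal distance `|x - y|`. -/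
abbrev S2 : Type := Metric.sphere (0 : EuclideanSpace ℝ (Fin 3)) 1

/-- The normalized surface area measure on `S²`. -/
def sigma : Measure S2 :=
  ((volume : Measure (EuclideanSpace ℝ (Fin 3))).toSphere Set.univ)⁻¹ •
    (volume : Measure (EuclideanSpace ℝ (Fin 3))).toSphere

/-- The normalized counting measure `A ↦ |A ∩ ω| / N` of an `N`-point configuration `ω`. -/
def countingMeasure (N : ℕ) (ω : Finset S2) : Measure S2 :=
  (N : ENNReal)⁻¹ • ∑ x ∈ ω, Measure.dirac x

/-- Weak-star convergence of the normalized counting measures to `sigma`. -/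
def IsEquidistributed (ω : ℕ → Finset S2) : Prop :=
  ∀ f : C(S2, ℝ),
    Tendsto (fun N : ℕ => ∫ x, f x ∂(countingMeasure N (ω N))) atTop (𝓝 (∫ x, f x ∂sigma))

/-- The separation `δ(ω) = min_{x ≠ y} |x - y|` (for `ω` with at least two points). -/
def separation (ω : Finset S2) : ℝ := Set.infsep (ω : Set S2)

/-- The covering radius `η(ω) = max_{y ∈ S²} min_{x ∈ ω} |x - y|` (for nonempty `ω`). -/
def coveringRadius (ω : Finset S2) : ℝ := ⨆ y : S2, Metric.infDist y (ω : Set S2)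

/-- The mesh ratio `γ(ω) = η(ω) / δ(ω)`. -/
def meshRatio (ω : Finset S2) : ℝ := coveringRadius ω / separation ω

/-- The mesh ratios of the configurations `ω N`, `N ≥ 2`, are bounded. -/
def IsQuasiUniform (ω : ℕ → Finset S2) : Prop :=
  ∃ C : ℝ, ∀ N : ℕ, 2 ≤ N → meshRatio (ω N) ≤ C

/-- The point of `S²` with polar angle `φ` and azimuth `θ`. -/
def sphPoint (φ θ : ℝ) : S2 :=
  ⟨!₂[Real.sin φ * Real.cos θ, Real.sin φ * Real.sin θ, Real.cos φ], by
    rw [mem_sphere_zero_iff_norm, EuclideanSpace.norm_eq, Real.sqrt_eq_one]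
    simp only [Fin.sum_univ_three, Real.norm_eq_abs, sq_abs,
      Matrix.cons_val_zero, Matrix.cons_val_one, Matrix.cons_val]
    nlinarith [Real.sin_sq_add_cos_sq φ, Real.sin_sq_add_cos_sq θ]⟩

/-- The angular radius `φ_c` of the two polar caps. -/
def capAngle (N : ℕ) : ℝ := Real.arccos (1 - 2 / N)

/-- The ideal collar angle `δ_I`. -/
def idealAngle (N : ℕ) : ℝ := Real.sqrt (4 * Real.pi / N)

/-- The ideal number `n_I` of collars between the polar caps. -/
def idealCollars (N : ℕ) : ℝ := (Real.pi - 2 * capAngle N) / idealAngle N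

/-- The actual number `n` of collars between the polar caps. -/
def numCollars (N : ℕ) : ℕ := if N = 2 then 0 else max 1 (round (idealCollars N)).toNat

/-- The fitting collar angle `δ_F`. -/
def fittingAngle (N : ℕ) : ℝ := (Real.pi - 2 * capAngle N) / numCollars N

/-- The area `A_j` of the `j`-th ideal collar, `2 ≤ j ≤ n + 1`. -/
def collarArea (N j : ℕ) : ℝ :=
  2 * Real.pi * (Real.cos (capAngle N + ((j : ℝ) - 2) * fittingAngle N) -
    Real.cos (capAngle N + ((j : ℝ) - 1) * fittingAngle N))

/-- The ideal number `y_{j,I}` of cells of area `4π / N` in the `j`-th collar,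
`2 ≤ j ≤ n + 1`. -/
def idealCells (N j : ℕ) : ℝ := collarArea N j * N / (4 * Real.pi)

/-- Cumulative rounding: the pair `(y_j, a_j)`, where `y_1 = 1`, `a_1 = 0`,
`y_j = round (y_{j,I} + a_{j-1})` and `a_j = ∑_{2 ≤ k ≤ j} (y_{k,I} - y_k)`.
The value at `j = 0` plays no role; for the south polar cap see `numCells`. -/
def cumulativeRounding (N : ℕ) : ℕ → ℤ × ℝ
  | 0 => (0, 0)
  | 1 => (1, 0)
  | j + 2 =>
    let a := (cumulativeRounding N (j + 1)).2
    let y := round (idealCells N (j + 2) + a)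
    (y, a + (idealCells N (j + 2) - y))

/-- The number `y_j` of cells in the collar `C_j`, `1 ≤ j ≤ n + 2`, where `C_1` and `C_{n+2}`
are the polar caps. -/
def numCells (N j : ℕ) : ℕ :=
  if j = numCollars N + 2 then 1 else (cumulativeRounding N j).1.toNat

/-- The polar angle `φ_j` of the southern boundary of the collar `C_j`. -/
def latitude (N j : ℕ) : ℝ :=
  if j = 0 then 0
  else if j = numCollars N + 2 then Real.pi
  else Real.arccos (1 - 2 / N * ∑ k ∈ Finset.Icc 1 j, (numCells N k : ℝ))

/-- The center of the `k`-th cell of the collar `C_j`, where `θ j` is the starting angle of `C_j`: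
a pole if the cell is a polar cap, otherwise the midpoint in spherical coordinates of the cell
`φ_{j-1} ≤ φ ≤ φ_j`, `θ_j + k (2π / y_j) ≤ θ ≤ θ_j + (k + 1) (2π / y_j)`. -/
def cellCenter (N : ℕ) (θ : ℕ → ℝ) (j k : ℕ) : S2 :=
  if j = 1 then sphPoint 0 0
  else if j = numCollars N + 2 then sphPoint Real.pi 0
  else
    sphPoint ((latitude N (j - 1) + latitude N j) / 2)
      (((θ j + k * (2 * Real.pi / numCells N j)) +
        (θ j + (k + 1) * (2 * Real.pi / numCells N j))) / 2)

open Classical in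
/-- The zonal equal area configuration with `N ≥ 2` points and starting angles `θ j`. -/
def zonalConfig (N : ℕ) (θ : ℕ → ℝ) : Finset S2 :=
  (Finset.Icc 1 (numCollars N + 2)).biUnion fun j =>
    (Finset.range (numCells N j)).image fun k => cellCenter N θ j k

end

end ZonalEqualArea

/-! ### Cumulative rounding, cell counts and the latitudes of the boundaries. -/

namespace ZonalEqualArea

noncomputable section

open Real Finset

/-! Write s = 1/√N. Cumulative rounding keeps |a_j| ≤ 1/2, and the last error is an integer, hence
zero. So there are exactly N cells, and the cosine of every boundary differs from its ideal value by
at most s² (`abs_cos_latitude_sub_le`). For n ≥ 2 the numbers n and n_I differ by at most 1/2, so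
δ_F lies within √π s/n of 2√π s. The boundaries that are not cap boundaries stay away from the
poles, where an error s² in the cosine moves the angle by at most 0.34 s. This pins the half heights
h of the collars between multiples of s (`halfHeight_bounds`).

Since areas are exact, a collar with middle angle m and half height h has N sin m sin h cells
(`numCells_eq_mul_sin`). A cell therefore has azimuthal half width π s²/(sin m sin h), and the
squared distance from its center is at most h² plus π² s⁴/sin² h times a distortion factor: m has
cancelled. With h = Hs this is an inequality in H against 3.5² (`cell_bound`). The cases n = 1 and N
≤ 3 are treated directly.

The same count gives separation 0.2 s inside a collar, and h ≥ s/3 gives it between collars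
(`le_dist_cellCenter`). Separated centers are distinct, so the configuration has as many points as
there are cells, and the mesh ratio is at most 3.5/0.2 = 17.5.

For equidistribution, every cell has σ-measure 1/N and lies within 3.5 s of its center, so uniform
continuity of f suffices once σ is written in spherical coordinates (`integral_sigma`). -/

/-- The polar angle of the southern boundary of the `j`-th ideal collar. -/
def idealLatitude (N j : ℕ) : ℝ := capAngle N + ((j : ℝ) - 1) * fittingAngle N

/-- The accumulated rounding error `a_j`. -/
def roundingError (N j : ℕ) : ℝ := (cumulativeRounding N j).2

theorem two_div_le_one {N : ℕ} (hN : 2 ≤ N) : (2 : ℝ) / N ≤ 1 := by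
  have h : (2 : ℝ) ≤ N := by exact_mod_cast hN
  rw [div_le_one (by linarith)]
  exact h

theorem cos_capAngle {N : ℕ} (hN : 2 ≤ N) : cos (capAngle N) = 1 - 2 / N := by
  have h := two_div_le_one hN
  have h' : (0 : ℝ) ≤ 2 / N := by positivity
  exact cos_arccos (by linarith) (by linarith)

theorem capAngle_nonneg (N : ℕ) : 0 ≤ capAngle N := arccos_nonneg _

theorem capAngle_le_pi_div_two {N : ℕ} (hN : 2 ≤ N) : capAngle N ≤ π / 2 := by
  have h := two_div_le_one hN
  exact arccos_le_pi_div_two.2 (by linarith)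

theorem numCollars_two : numCollars 2 = 0 := by simp [numCollars]

theorem numCollars_of_ne {N : ℕ} (hN : N ≠ 2) :
    numCollars N = max 1 (round (idealCollars N)).toNat := by
  simp [numCollars, hN]

theorem one_le_numCollars {N : ℕ} (hN : N ≠ 2) : 1 ≤ numCollars N := by
  rw [numCollars_of_ne hN]
  exact le_max_left _ _

theorem fittingAngle_nonneg {N : ℕ} (hN : 2 ≤ N) : 0 ≤ fittingAngle N := by
  have h := capAngle_le_pi_div_two hN
  exact div_nonneg (by linarith) (Nat.cast_nonneg _)

@[simp]
theorem idealLatitude_one (N : ℕ) : idealLatitude N 1 = capAngle N := by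
  simp [idealLatitude]

theorem idealLatitude_last {N : ℕ} (hN : 2 ≤ N) :
    idealLatitude N (numCollars N + 1) = π - capAngle N := by
  rcases eq_or_ne N 2 with rfl | h
  · simp only [numCollars_two, zero_add, idealLatitude_one, capAngle]
    norm_num
    ring
  · have h1 : (numCollars N : ℝ) ≠ 0 := by
      have := one_le_numCollars h
      positivity
    simp only [idealLatitude, fittingAngle]
    push_cast
    field_simp
    ring

theorem idealLatitude_succ (N j : ℕ) :
    idealLatitude N (j + 1) = idealLatitude N j + fittingAngle N := by
  simp only [idealLatitude]
  push_cast
  ring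

theorem idealLatitude_mono {N : ℕ} (hN : 2 ≤ N) : Monotone (idealLatitude N) := by
  refine monotone_nat_of_le_succ fun j => ?_
  rw [idealLatitude_succ]
  linarith [fittingAngle_nonneg hN]

theorem capAngle_le_idealLatitude {N j : ℕ} (hN : 2 ≤ N) (hj : 1 ≤ j) :
    capAngle N ≤ idealLatitude N j := by
  simpa using idealLatitude_mono hN hj

theorem idealLatitude_le {N j : ℕ} (hN : 2 ≤ N) (hj : j ≤ numCollars N + 1) :
    idealLatitude N j ≤ π - capAngle N := by
  rw [← idealLatitude_last hN]
  exact idealLatitude_mono hN hj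

theorem idealCells_eq (N j : ℕ) :
    idealCells N (j + 1) = N / 2 * (cos (idealLatitude N j) - cos (idealLatitude N (j + 1))) := by
  have hπ := pi_ne_zero
  simp only [idealCells, collarArea, idealLatitude]
  push_cast
  rw [show (j : ℝ) + 1 - 2 = j - 1 by ring]
  field_simp
  ring

theorem idealCells_nonneg {N j : ℕ} (hN : 2 ≤ N) (hj : 1 ≤ j) (hj' : j ≤ numCollars N) :
    0 ≤ idealCells N (j + 1) := by
  rw [idealCells_eq]
  have h := cos_le_cos_of_nonneg_of_le_pi
    ((capAngle_nonneg N).trans (capAngle_le_idealLatitude hN hj))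
    ((idealLatitude_le (j := j + 1) hN (by omega)).trans (by linarith [capAngle_nonneg N]))
    (idealLatitude_mono hN j.le_succ)
  exact mul_nonneg (by positivity) (by linarith)

theorem cumulativeRounding_one (N : ℕ) : cumulativeRounding N 1 = (1, 0) := rfl

@[simp]
theorem roundingError_one (N : ℕ) : roundingError N 1 = 0 := rfl

theorem cumulativeRounding_fst_succ (N : ℕ) {j : ℕ} (hj : 1 ≤ j) :
    (cumulativeRounding N (j + 1)).1 = round (idealCells N (j + 1) + roundingError N j) := by
  obtain ⟨k, rfl⟩ := Nat.exists_eq_add_of_le' hj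
  rfl

theorem roundingError_succ (N : ℕ) {j : ℕ} (hj : 1 ≤ j) :
    roundingError N (j + 1) =
      roundingError N j + idealCells N (j + 1) - (cumulativeRounding N (j + 1)).1 := by
  obtain ⟨k, rfl⟩ := Nat.exists_eq_add_of_le' hj
  simp only [roundingError, cumulativeRounding]
  ring

/-- The previous error is fed into the rounding, so each new error has the form x - round x and
errors do not accumulate. -/
theorem abs_roundingError_le (N : ℕ) {j : ℕ} (hj : 1 ≤ j) : |roundingError N j| ≤ 1 / 2 := by
  rcases hj.eq_or_lt with rfl | h
  · simp
  · obtain ⟨k, rfl⟩ := Nat.exists_eq_add_of_le' h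
    rw [roundingError_succ N (by omega), cumulativeRounding_fst_succ N (by omega)]
    rw [add_comm (roundingError _ _)]
    exact abs_sub_round _

/-- The rounded quantity is at least -1/2, and halves are rounded up. Hence `toNat` in `numCells`
loses nothing. -/
theorem cumulativeRounding_fst_nonneg {N j : ℕ} (hN : 2 ≤ N) (hj : 1 ≤ j)
    (hj' : j ≤ numCollars N + 1) : 0 ≤ (cumulativeRounding N j).1 := by
  rcases hj.eq_or_lt with rfl | h
  · simp [cumulativeRounding_one]
  · obtain ⟨k, rfl⟩ := Nat.exists_eq_add_of_le' h
    rw [cumulativeRounding_fst_succ N (by omega), round_eq, Int.floor_nonneg]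
    have h1 := idealCells_nonneg (j := k + 1) hN (by omega) (by omega)
    have h2 := (abs_le.1 (abs_roundingError_le N (j := k + 1) (by omega))).1
    linarith

theorem sum_cumulativeRounding {N j : ℕ} (hN : 2 ≤ N) (hj : 1 ≤ j) :
    (∑ k ∈ Icc 1 j, ((cumulativeRounding N k).1 : ℝ)) =
      N / 2 * (1 - cos (idealLatitude N j)) - roundingError N j := by
  induction j, hj using Nat.le_induction with
  | base =>
    have : (N : ℝ) ≠ 0 := by positivity
    simp [cumulativeRounding_one, cos_capAngle hN]
    field_simp
  | succ j hj ih =>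
    rw [Finset.sum_Icc_succ_top (by omega), ih, roundingError_succ N hj,
      idealCells_eq]
    ring

theorem numCells_of_le {N j : ℕ} (hj : j ≤ numCollars N + 1) :
    numCells N j = (cumulativeRounding N j).1.toNat := by
  simp [numCells, show j ≠ numCollars N + 2 by omega]

theorem numCells_one (N : ℕ) : numCells N 1 = 1 := by
  rw [numCells_of_le (by omega)]
  rfl

theorem numCells_last (N : ℕ) : numCells N (numCollars N + 2) = 1 := by
  simp [numCells]

theorem cast_numCells {N j : ℕ} (hN : 2 ≤ N) (hj : 1 ≤ j) (hj' : j ≤ numCollars N + 1) :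
    (numCells N j : ℤ) = (cumulativeRounding N j).1 := by
  rw [numCells_of_le hj', Int.toNat_of_nonneg (cumulativeRounding_fst_nonneg hN hj hj')]

theorem sum_numCells_eq {N j : ℕ} (hN : 2 ≤ N) (hj : 1 ≤ j) (hj' : j ≤ numCollars N + 1) :
    (∑ k ∈ Icc 1 j, (numCells N k : ℝ)) =
      N / 2 * (1 - cos (idealLatitude N j)) - roundingError N j := by
  rw [← sum_cumulativeRounding hN hj]
  refine Finset.sum_congr rfl fun k hk => ?_
  rw [Finset.mem_Icc] at hk
  rw [← cast_numCells hN hk.1 (hk.2.trans hj'), Int.cast_natCast]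

/-- The ideal boundaries end exactly at the southern cap, so the total of the ideal counts is an
integer. The final error is then an integer of absolute value at most 1/2. -/
theorem roundingError_last {N : ℕ} (hN : 2 ≤ N) : roundingError N (numCollars N + 1) = 0 := by
  have h := sum_cumulativeRounding (j := numCollars N + 1) hN (by omega)
  rw [idealLatitude_last hN, cos_pi_sub, cos_capAngle hN] at h
  have hN0 : (N : ℝ) ≠ 0 := by positivity
  have h1 : roundingError N (numCollars N + 1) =
      (((N : ℤ) - 1 - ∑ k ∈ Icc 1 (numCollars N + 1), (cumulativeRounding N k).1 : ℤ) : ℝ) := by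
    push_cast
    rw [h]
    field_simp
    ring
  have h2 := abs_roundingError_le N (j := numCollars N + 1) (by omega)
  rw [h1] at h2 ⊢
  rw [← Int.cast_abs] at h2
  have h3 : |(N : ℤ) - 1 - ∑ k ∈ Icc 1 (numCollars N + 1), (cumulativeRounding N k).1| < 1 := by
    have : ((|(N : ℤ) - 1 - ∑ k ∈ Icc 1 (numCollars N + 1), (cumulativeRounding N k).1| : ℤ) : ℝ)
      < (1 : ℤ) := h2.trans_lt (by norm_num)
    exact_mod_cast this
  rw [Int.abs_lt_one_iff.1 h3, Int.cast_zero]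

theorem sum_numCells {N : ℕ} (hN : 2 ≤ N) :
    ∑ k ∈ Icc 1 (numCollars N + 2), numCells N k = N := by
  have h := sum_numCells_eq (j := numCollars N + 1) hN (by omega) le_rfl
  rw [idealLatitude_last hN, cos_pi_sub, cos_capAngle hN, roundingError_last hN] at h
  have hN0 : (N : ℝ) ≠ 0 := by positivity
  rw [Finset.sum_Icc_succ_top (by omega), numCells_last]
  have : (((∑ k ∈ Icc 1 (numCollars N + 1), numCells N k) + 1 : ℕ) : ℝ) = N := by
    push_cast
    rw [h]
    field_simp
    ring
  exact_mod_cast this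

theorem latitude_of_mem {N j : ℕ} (hj : 1 ≤ j) (hj' : j ≤ numCollars N + 1) :
    latitude N j = arccos (1 - 2 / N * ∑ k ∈ Icc 1 j, (numCells N k : ℝ)) := by
  simp [latitude, show j ≠ 0 by omega, show j ≠ numCollars N + 2 by omega]

@[simp]
theorem latitude_zero (N : ℕ) : latitude N 0 = 0 := by simp [latitude]

theorem latitude_last (N : ℕ) : latitude N (numCollars N + 2) = π := by simp [latitude]

theorem latitude_nonneg (N j : ℕ) : 0 ≤ latitude N j := by
  unfold latitude
  split_ifs
  exacts [le_rfl, pi_pos.le, arccos_nonneg _]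

theorem latitude_le_pi (N j : ℕ) : latitude N j ≤ π := by
  unfold latitude
  split_ifs
  exacts [pi_pos.le, le_rfl, arccos_le_pi _]

/-- The area north of each boundary is the area of the cells north of it. -/
theorem cos_latitude {N j : ℕ} (hN : 2 ≤ N) (hj : j ≤ numCollars N + 2) :
    cos (latitude N j) = 1 - 2 / N * ∑ k ∈ Icc 1 j, (numCells N k : ℝ) := by
  have hN0 : (N : ℝ) ≠ 0 := by positivity
  rcases Nat.eq_zero_or_pos j with rfl | h0
  · simp
  rcases hj.eq_or_lt with rfl | h1
  · rw [latitude_last, ← Nat.cast_sum, sum_numCells hN, cos_pi]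
    field_simp
    norm_num
  · rw [latitude_of_mem h0 (by omega)]
    -- Partial sums stay in [0, N], so the argument of `arccos` is in [-1, 1] and is not clamped.
    have h2 : (∑ k ∈ Icc 1 j, (numCells N k : ℝ)) ≤ N := by
      rw [← Nat.cast_sum]
      calc ((∑ k ∈ Icc 1 j, numCells N k : ℕ) : ℝ)
          ≤ ((∑ k ∈ Icc 1 (numCollars N + 2), numCells N k : ℕ) : ℝ) := by
            exact_mod_cast Finset.sum_le_sum_of_subset (Finset.Icc_subset_Icc_right hj)
        _ = N := by rw [sum_numCells hN]
    have h3 : 0 ≤ ∑ k ∈ Icc 1 j, (numCells N k : ℝ) := Finset.sum_nonneg fun _ _ => by positivity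
    have h4 : (0 : ℝ) ≤ 2 / N := by positivity
    have h5 : 2 / (N : ℝ) * ∑ k ∈ Icc 1 j, (numCells N k : ℝ) ≤ 2 / N * N := by gcongr
    rw [div_mul_cancel₀ _ hN0] at h5
    rw [cos_arccos (by linarith) (by nlinarith)]

theorem cos_latitude_sub {N j : ℕ} (hN : 2 ≤ N) (hj : j + 1 ≤ numCollars N + 2) :
    cos (latitude N j) - cos (latitude N (j + 1)) = 2 / N * numCells N (j + 1) := by
  rw [cos_latitude hN hj, cos_latitude hN (by omega), Finset.sum_Icc_succ_top (by omega)]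
  ring

theorem latitude_le_succ {N j : ℕ} (hN : 2 ≤ N) (hj : j + 1 ≤ numCollars N + 2) :
    latitude N j ≤ latitude N (j + 1) := by
  have h := cos_latitude_sub hN hj
  have h' : 0 ≤ 2 / (N : ℝ) * numCells N (j + 1) := by positivity
  by_contra! hlt
  have := cos_lt_cos_of_nonneg_of_le_pi (latitude_nonneg N (j + 1)) (latitude_le_pi N j) hlt
  linarith

theorem latitude_mono {N i j : ℕ} (hN : 2 ≤ N) (hij : i ≤ j) (hj : j ≤ numCollars N + 2) :
    latitude N i ≤ latitude N j := by
  induction j, hij using Nat.le_induction with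
  | base => exact le_rfl
  | succ j _ ih => exact (ih (by omega)).trans (latitude_le_succ hN hj)

theorem cos_latitude_eq_cos_idealLatitude_add {N j : ℕ} (hN : 2 ≤ N) (hj : 1 ≤ j)
    (hj' : j ≤ numCollars N + 1) :
    cos (latitude N j) = cos (idealLatitude N j) + 2 * roundingError N j / N := by
  have hN0 : (N : ℝ) ≠ 0 := by positivity
  rw [cos_latitude hN (by omega), sum_numCells_eq hN hj hj']
  field_simp
  ring

theorem abs_cos_latitude_sub_le {N j : ℕ} (hN : 2 ≤ N) (hj : 1 ≤ j)
    (hj' : j ≤ numCollars N + 1) :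
    |cos (latitude N j) - cos (idealLatitude N j)| ≤ 1 / N := by
  have h := abs_roundingError_le N hj
  rw [cos_latitude_eq_cos_idealLatitude_add hN hj hj', add_sub_cancel_left, abs_div, abs_mul,
    Nat.abs_cast]
  gcongr
  rw [abs_two]
  linarith

theorem latitude_one {N : ℕ} (hN : 2 ≤ N) : latitude N 1 = capAngle N := by
  refine injOn_cos ⟨latitude_nonneg _ _, latitude_le_pi _ _⟩ ⟨capAngle_nonneg N, arccos_le_pi _⟩ ?_
  rw [cos_latitude_eq_cos_idealLatitude_add hN le_rfl (by omega)]
  simp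

theorem latitude_numCollars_add_one {N : ℕ} (hN : 2 ≤ N) :
    latitude N (numCollars N + 1) = π - capAngle N := by
  refine injOn_cos ⟨latitude_nonneg _ _, latitude_le_pi _ _⟩
    ⟨by linarith [capAngle_le_pi_div_two hN, pi_pos], by linarith [capAngle_nonneg N]⟩ ?_
  rw [cos_latitude_eq_cos_idealLatitude_add hN (by omega) le_rfl, idealLatitude_last hN,
    roundingError_last hN]
  simp

end

end ZonalEqualArea

/-! ### Collar heights in units of 1/√N. -/

namespace ZonalEqualArea

noncomputable section

open Real Finset

/-- The length scale `1 / √N` of an `N`-point configuration. -/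
def scale (N : ℕ) : ℝ := (√N)⁻¹

theorem scale_pos {N : ℕ} (hN : 2 ≤ N) : 0 < scale N := by
  have : (0 : ℝ) < N := by positivity
  exact inv_pos.2 (sqrt_pos.2 this)

theorem scale_sq (N : ℕ) : scale N ^ 2 = 1 / N := by
  rw [scale, inv_pow, sq_sqrt (Nat.cast_nonneg N), one_div]

theorem natCast_mul_scale_sq {N : ℕ} (hN : 2 ≤ N) : N * scale N ^ 2 = 1 := by
  have : (N : ℝ) ≠ 0 := by positivity
  rw [scale_sq, mul_one_div_cancel this]

theorem idealAngle_eq (N : ℕ) : idealAngle N = 2 * √π * scale N := by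
  rw [idealAngle, scale, sqrt_div (by positivity), sqrt_mul (by norm_num),
    show (4 : ℝ) = 2 ^ 2 by norm_num, sqrt_sq (by norm_num)]
  rfl

theorem lt_sqrt_pi : 1.7724 < √π := by
  rw [lt_sqrt (by norm_num)]
  linarith [pi_gt_d4]

theorem sqrt_pi_lt : √π < 1.7725 := by
  rw [sqrt_lt' (by norm_num)]
  linarith [pi_lt_d4]

/-- The chord from the pole to the cap boundary has length 2/√N, and an arc is at least as long as
its chord. -/
theorem two_mul_scale_le_capAngle {N : ℕ} (hN : 2 ≤ N) : 2 * scale N ≤ capAngle N := by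
  have h := one_sub_sq_div_two_le_cos (x := capAngle N)
  rw [cos_capAngle hN] at h
  have h1 := scale_sq N
  refine abs_le_of_sq_le_sq' (a := 2 * scale N) ?_ (capAngle_nonneg N) |>.2
  have : (2 : ℝ) / N = 2 * (1 / N) := by ring
  rw [mul_pow, h1]
  linarith

theorem numCollars_mul_fittingAngle {N : ℕ} (hN : N ≠ 2) :
    numCollars N * fittingAngle N = π - 2 * capAngle N := by
  have h1 : (numCollars N : ℝ) ≠ 0 := by
    have := one_le_numCollars hN
    positivity
  rw [fittingAngle, mul_div_cancel₀ _ h1]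

theorem idealCollars_mul_idealAngle {N : ℕ} (hN : 2 ≤ N) :
    idealCollars N * idealAngle N = π - 2 * capAngle N := by
  have h1 : idealAngle N ≠ 0 := by
    rw [idealAngle_eq]
    have := scale_pos hN
    positivity
  rw [idealCollars, div_mul_cancel₀ _ h1]

theorem idealCollars_lt {N : ℕ} (hN : N ≠ 2) : idealCollars N < numCollars N + 1 / 2 := by
  rw [numCollars_of_ne hN]
  have h1 : idealCollars N + 1 / 2 < round (idealCollars N) + 1 := by
    rw [round_eq]
    exact Int.lt_floor_add_one _
  -- Both `toNat` and the maximum with 1 can only increase the rounded value, so the upper bound on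
  -- n_I survives them.
  have h2 : ((round (idealCollars N) : ℤ) : ℝ) ≤
      ((max 1 (round (idealCollars N)).toNat : ℕ) : ℝ) := by
    have : round (idealCollars N) ≤ ((max 1 (round (idealCollars N)).toNat : ℕ) : ℤ) := by omega
    exact_mod_cast this
  linarith

theorem le_idealCollars {N : ℕ} (hn : 2 ≤ numCollars N) :
    numCollars N - 1 / 2 ≤ idealCollars N := by
  have hN : N ≠ 2 := by
    rintro rfl
    simp [numCollars_two] at hn
  have h := numCollars_of_ne hN
  -- With n ≥ 2 the maximum with 1 is not attained by 1. For n = 1 the lower bound can fail, which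
  -- is why one collar is a separate case throughout.
  have h0 : ((numCollars N : ℕ) : ℤ) = round (idealCollars N) := by omega
  have h1 : ((round (idealCollars N) : ℤ) : ℝ) ≤ idealCollars N + 1 / 2 := by
    rw [round_eq]
    exact Int.floor_le _
  rw [← h0, Int.cast_natCast] at h1
  linarith

theorem ne_two_of_numCollars {N : ℕ} (hN : 2 ≤ N) (hn : 1 ≤ numCollars N) : N ≠ 2 := by
  rintro rfl
  simp [numCollars_two] at hn

theorem numCollars_mul_fittingAngle_le {N : ℕ} (hN : 2 ≤ N) (hn : 1 ≤ numCollars N) :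
    numCollars N * fittingAngle N ≤ (2 * numCollars N + 1) * √π * scale N := by
  have hN2 := ne_two_of_numCollars hN hn
  rw [numCollars_mul_fittingAngle hN2, ← idealCollars_mul_idealAngle hN, idealAngle_eq]
  have h := idealCollars_lt hN2
  have h0 : 0 < √π * scale N := mul_pos (by positivity) (scale_pos hN)
  nlinarith

theorem le_numCollars_mul_fittingAngle {N : ℕ} (hN : 2 ≤ N) (hn : 2 ≤ numCollars N) :
    (2 * numCollars N - 1) * √π * scale N ≤ numCollars N * fittingAngle N := by
  have hN2 := ne_two_of_numCollars hN (by omega)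
  rw [numCollars_mul_fittingAngle hN2, ← idealCollars_mul_idealAngle hN, idealAngle_eq]
  have h := le_idealCollars hn
  have h0 : 0 < √π * scale N := mul_pos (by positivity) (scale_pos hN)
  nlinarith

/-- The bound with 1/n weakens to 1/k, uniformly over all n ≥ k. It is used with k = 1, 2, 3. -/
theorem fittingAngle_le {N k : ℕ} (hN : 2 ≤ N) (hk : 1 ≤ k) (hn : k ≤ numCollars N) :
    fittingAngle N ≤ (2 + 1 / k) * √π * scale N := by
  have h := numCollars_mul_fittingAngle_le hN (by omega)
  have hk0 : (0 : ℝ) < k := by positivity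
  have hkn : (k : ℝ) ≤ numCollars N := by exact_mod_cast hn
  have h0 : 0 < √π * scale N := mul_pos (by positivity) (scale_pos hN)
  have h1 : fittingAngle N ≤ (2 + 1 / numCollars N) * √π * scale N := by
    have h2 : (0 : ℝ) < numCollars N := by linarith
    rw [← mul_le_mul_iff_right₀ h2]
    refine h.trans_eq ?_
    field_simp
  refine h1.trans ?_
  rw [mul_assoc, mul_assoc]
  gcongr

theorem le_fittingAngle {N k : ℕ} (hN : 2 ≤ N) (hk : 2 ≤ k) (hn : k ≤ numCollars N) :
    (2 - 1 / k) * √π * scale N ≤ fittingAngle N := by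
  have h := le_numCollars_mul_fittingAngle hN (by omega)
  have hk0 : (0 : ℝ) < k := by positivity
  have hkn : (k : ℝ) ≤ numCollars N := by exact_mod_cast hn
  have h0 : 0 < √π * scale N := mul_pos (by positivity) (scale_pos hN)
  have h1 : (2 - 1 / numCollars N) * √π * scale N ≤ fittingAngle N := by
    have h2 : (0 : ℝ) < numCollars N := by linarith
    rw [← mul_le_mul_iff_right₀ h2]
    refine Eq.trans_le ?_ h
    field_simp
  refine le_trans ?_ h1
  rw [mul_assoc, mul_assoc]
  gcongr

theorem scale_mul_le {N k : ℕ} (hN : 2 ≤ N) (hk : 2 ≤ k) (hn : k ≤ numCollars N) :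
    (4 + (2 * k - 1) * √π) * scale N ≤ π := by
  have h := le_numCollars_mul_fittingAngle hN (hk.trans hn)
  have hkn : (k : ℝ) ≤ numCollars N := by exact_mod_cast hn
  have h0 : 0 < √π * scale N := mul_pos (by positivity) (scale_pos hN)
  rw [numCollars_mul_fittingAngle (ne_two_of_numCollars hN (by omega))] at h
  have h2 := two_mul_scale_le_capAngle hN
  nlinarith

theorem min_le_sin {x c : ℝ} (h1 : c ≤ x) (h2 : c ≤ π - x) (hx : x ∈ Set.Icc 0 π) :
    2 / π * c ≤ sin x := by
  rcases le_total x (π / 2) with h | h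
  · refine le_trans ?_ (mul_le_sin hx.1 h)
    gcongr
  · rw [← sin_pi_sub]
    refine le_trans ?_ (mul_le_sin (by linarith [hx.2]) (by linarith))
    gcongr

/-- A move by 0.34 s changes the cosine by 2 sin(y + 0.17 s) sin(0.17 s). Jordan's inequality makes
the first sine at least 3.04 s, and 2 · 3.04 · 0.1699 > 1. -/
theorem sub_le_of_cos_sub_le {x y s : ℝ} (hs : 0 < s) (hs' : s ≤ 0.2444)
    (hy : 4.954 * s ≤ y) (hy' : 4.954 * s ≤ π - y) (hx : x ∈ Set.Icc 0 π)
    (h : cos y - cos x ≤ s ^ 2) : x - y ≤ 0.34 * s := by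
  by_contra! hlt
  have h1 : cos x < cos (y + 0.34 * s) :=
    cos_lt_cos_of_nonneg_of_le_pi (by linarith) hx.2 (by linarith)
  have h2 : cos y - cos (y + 0.34 * s) = 2 * sin (y + 0.17 * s) * sin (0.17 * s) := by
    rw [cos_sub_cos, show (y + (y + 0.34 * s)) / 2 = y + 0.17 * s by ring,
      show (y - (y + 0.34 * s)) / 2 = -(0.17 * s) by ring, sin_neg]
    ring
  have h3 : 2 / π * (4.784 * s) ≤ sin (y + 0.17 * s) :=
    min_le_sin (by linarith) (by linarith) ⟨by linarith, by linarith⟩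
  have h4 : 0.1699 * s ≤ sin (0.17 * s) := by
    refine le_trans ?_ (sin_ge_sub_cube (by positivity))
    have : s ^ 2 ≤ 0.06 := by nlinarith
    nlinarith
  have h5 : (0.636 : ℝ) ≤ 2 / π := by
    rw [le_div_iff₀ pi_pos]
    linarith [pi_lt_d4]
  have h6 : 3.04 * s ≤ sin (y + 0.17 * s) := by nlinarith
  have h8 : 0 ≤ sin (y + 0.17 * s) := by linarith
  have h7 : 3.04 * s * (0.1699 * s) ≤ sin (y + 0.17 * s) * sin (0.17 * s) := by gcongr
  nlinarith

theorem abs_sub_le_of_abs_cos_sub_le {x y s : ℝ} (hs : 0 < s) (hs' : s ≤ 0.2444)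
    (hy : 4.954 * s ≤ y) (hy' : 4.954 * s ≤ π - y) (hx : x ∈ Set.Icc 0 π)
    (h : |cos x - cos y| ≤ s ^ 2) : |x - y| ≤ 0.34 * s := by
  rw [abs_le] at h ⊢
  have h1 := sub_le_of_cos_sub_le hs hs' hy hy' hx (by linarith)
  have h2 := sub_le_of_cos_sub_le (x := π - x) (y := π - y) hs hs' hy' (by linarith)
    ⟨by linarith [hx.2], by linarith [hx.1]⟩ (by rw [cos_pi_sub, cos_pi_sub]; linarith)
  exact ⟨by linarith, h1⟩

/-- At the equator the cosine has slope -1, so the shift is about s² ≤ 0.3373 s. The margin up to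
0.34 s absorbs the cubic term of the sine. -/
theorem sub_pi_div_two_le_of_neg_le_cos {x s : ℝ} (hs : 0 < s) (hs' : s ≤ 0.3373)
    (hx : x ≤ π) (h : -s ^ 2 ≤ cos x) : x - π / 2 ≤ 0.34 * s := by
  by_contra! hlt
  have h1 : cos x < cos (0.34 * s + π / 2) :=
    cos_lt_cos_of_nonneg_of_le_pi (by positivity) hx (by linarith)
  rw [cos_add_pi_div_two] at h1
  have h2 : 0.34 * s - (0.34 * s) ^ 3 / 6 ≤ sin (0.34 * s) := sin_ge_sub_cube (by positivity)
  have h3 : s ^ 2 ≤ 0.114 := by nlinarith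
  nlinarith

theorem abs_sub_pi_div_two_le_of_abs_cos_le {x s : ℝ} (hs : 0 < s) (hs' : s ≤ 0.3373)
    (hx : x ∈ Set.Icc 0 π) (h : |cos x| ≤ s ^ 2) : |x - π / 2| ≤ 0.34 * s := by
  rw [abs_le] at h ⊢
  have h1 := sub_pi_div_two_le_of_neg_le_cos hs hs' hx.2 (by linarith)
  have h2 := sub_pi_div_two_le_of_neg_le_cos (x := π - x) hs hs' (by linarith [hx.1])
    (by rw [cos_pi_sub]; linarith)
  exact ⟨by linarith, h1⟩

/-- Half the height of the collar between `latitude N j` and `latitude N (j + 1)`. -/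
def halfHeight (N j : ℕ) : ℝ := (latitude N (j + 1) - latitude N j) / 2

theorem scale_le_of_numCollars_two {N : ℕ} (hN : 2 ≤ N) (hn : 2 ≤ numCollars N) :
    scale N ≤ 0.3373 := by
  have h := scale_mul_le hN le_rfl hn
  have h0 := scale_pos hN
  have h1 := lt_sqrt_pi
  push_cast at h
  nlinarith [pi_lt_d4]

theorem scale_le_of_numCollars_three {N : ℕ} (hN : 2 ≤ N) (hn : 3 ≤ numCollars N) :
    scale N ≤ 0.2444 := by
  have h := scale_mul_le hN (by norm_num) hn
  have h0 := scale_pos hN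
  have h1 := lt_sqrt_pi
  push_cast at h
  nlinarith [pi_lt_d4]

theorem halfHeight_bounds_of_numCollars_eq_two {N j : ℕ} (hN : 2 ≤ N) (hn : numCollars N = 2)
    (hj : 1 ≤ j) (hj' : j ≤ numCollars N) :
    1.159 * scale N ≤ halfHeight N j ∧ halfHeight N j ≤ 2.42 * scale N := by
  have hs := scale_pos hN
  have h1 := latitude_one hN
  have h3 := latitude_numCollars_add_one hN
  have hl := le_fittingAngle (k := 2) hN le_rfl hn.ge
  have hu := fittingAngle_le (k := 2) hN (by norm_num) hn.ge
  have hf := numCollars_mul_fittingAngle (N := N) (ne_two_of_numCollars hN (by omega))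
  have h2 := abs_cos_latitude_sub_le (j := 2) hN (by norm_num) (by omega)
  -- With two collars the only boundary that rounding can move is ideally the equator.
  have hψ : idealLatitude N 2 = π / 2 := by
    rw [idealLatitude_succ, idealLatitude_one]
    rw [hn] at hf
    push_cast at hf
    linarith
  rw [hψ, cos_pi_div_two, sub_zero, ← scale_sq] at h2
  have h4 := abs_le.1 (abs_sub_pi_div_two_le_of_abs_cos_le hs
    (scale_le_of_numCollars_two hN hn.ge) ⟨latitude_nonneg N 2, latitude_le_pi N 2⟩ h2)
  have h5 : 2.6586 * scale N ≤ fittingAngle N := by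
    refine le_trans ?_ hl
    gcongr
    push_cast
    linarith [lt_sqrt_pi]
  have h6 : fittingAngle N ≤ 4.4315 * scale N := by
    refine hu.trans ?_
    gcongr
    push_cast
    linarith [sqrt_pi_lt]
  rw [hn] at hj' h3 hf
  push_cast at hf
  unfold halfHeight
  interval_cases j
  · rw [h1]
    constructor <;> linarith
  · rw [show 2 + 1 = 3 from rfl, show latitude N 3 = π - capAngle N from h3]
    constructor <;> linarith

theorem abs_latitude_sub_idealLatitude_le {N j : ℕ} (hN : 2 ≤ N) (hn : 3 ≤ numCollars N)
    (hj : 1 ≤ j) (hj' : j ≤ numCollars N + 1) :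
    |latitude N j - idealLatitude N j| ≤ 0.34 * scale N := by
  have hs := scale_pos hN
  rcases hj.eq_or_lt with rfl | hj1
  · rw [latitude_one hN, idealLatitude_one, sub_self, abs_zero]
    positivity
  rcases hj'.eq_or_lt with rfl | hj2
  · rw [latitude_numCollars_add_one hN, idealLatitude_last hN, sub_self, abs_zero]
    positivity
  have h2 := abs_cos_latitude_sub_le hN hj hj'
  rw [← scale_sq] at h2
  have hl := le_fittingAngle (k := 3) hN (by norm_num) hn
  -- A boundary strictly between the cap boundaries is ideally at least one fitting angle from each
  -- cap: 2 + 2.954 = 4.954 is the constant in `abs_sub_le_of_abs_cos_sub_le`.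
  have h5 : 2.954 * scale N ≤ fittingAngle N := by
    refine le_trans ?_ hl
    gcongr
    push_cast
    linarith [lt_sqrt_pi]
  have hc := two_mul_scale_le_capAngle hN
  have ha : idealLatitude N 2 ≤ idealLatitude N j := idealLatitude_mono hN hj1
  have hb : idealLatitude N (j + 1) ≤ π - capAngle N := idealLatitude_le hN (by omega)
  rw [idealLatitude_succ, idealLatitude_one] at ha
  rw [idealLatitude_succ] at hb
  exact abs_sub_le_of_abs_cos_sub_le hs (scale_le_of_numCollars_three hN hn) (by linarith)
    (by linarith) ⟨latitude_nonneg N j, latitude_le_pi N j⟩ h2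

/-- Each of the two boundaries moves by at most 0.34 s: (2.954 - 0.68)/2 = 1.137, and (4.136 +
0.68)/2 < 2.42. -/
theorem halfHeight_bounds_of_three_le_numCollars {N j : ℕ} (hN : 2 ≤ N) (hn : 3 ≤ numCollars N)
    (hj : 1 ≤ j) (hj' : j ≤ numCollars N) :
    1.137 * scale N ≤ halfHeight N j ∧ halfHeight N j ≤ 2.42 * scale N := by
  have hs := scale_pos hN
  have h1 := abs_le.1 (abs_latitude_sub_idealLatitude_le (j := j) hN hn hj (by omega))
  have h2 := abs_le.1 (abs_latitude_sub_idealLatitude_le (j := j + 1) hN hn (by omega) (by omega))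
  have hl := le_fittingAngle (k := 3) hN (by norm_num) hn
  have hu := fittingAngle_le (k := 3) hN (by norm_num) hn
  have h5 : 2.954 * scale N ≤ fittingAngle N := by
    refine le_trans ?_ hl
    gcongr
    push_cast
    linarith [lt_sqrt_pi]
  have h6 : fittingAngle N ≤ 4.136 * scale N := by
    refine hu.trans ?_
    gcongr
    push_cast
    linarith [sqrt_pi_lt]
  rw [idealLatitude_succ] at h2
  unfold halfHeight
  constructor <;> linarith

theorem halfHeight_of_numCollars_eq_one {N : ℕ} (hN : 2 ≤ N) (hn : numCollars N = 1) :
    halfHeight N 1 = π / 2 - capAngle N := by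
  have h3 := latitude_numCollars_add_one hN
  rw [hn] at h3
  rw [halfHeight, h3, latitude_one hN]
  ring

theorem sin_halfHeight_of_numCollars_eq_one {N : ℕ} (hN : 2 ≤ N) (hn : numCollars N = 1) :
    sin (halfHeight N 1) = 1 - 2 / N := by
  rw [halfHeight_of_numCollars_eq_one hN hn, sin_pi_div_two_sub, cos_capAngle hN]

/-- Both constants are dictated by a single collar, where sin h = 1 - 2/N ≥ 1/3 ≥ s/3 and h ≤
(3/2)√π s < 2.66 s. -/
theorem halfHeight_bounds {N j : ℕ} (hN : 2 ≤ N) (hj : 1 ≤ j) (hj' : j ≤ numCollars N) :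
    1 / 3 * scale N ≤ halfHeight N j ∧ halfHeight N j ≤ 2.66 * scale N := by
  have hs := scale_pos hN
  rcases lt_trichotomy (numCollars N) 2 with h | h | h
  · have hn : numCollars N = 1 := by omega
    obtain rfl : j = 1 := by omega
    have hN3 : 3 ≤ N := by
      have := ne_two_of_numCollars hN (by omega)
      omega
    have hN3' : (3 : ℝ) ≤ N := by exact_mod_cast hN3
    have h1 := halfHeight_of_numCollars_eq_one hN hn
    constructor
    · have h2 := sin_le (x := halfHeight N 1) (by linarith [capAngle_le_pi_div_two hN])
      rw [sin_halfHeight_of_numCollars_eq_one hN hn] at h2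
      have h3 : 2 / (N : ℝ) ≤ 2 / 3 := by gcongr
      have h4 : scale N ≤ 1 := by
        have := scale_sq N
        have h5 : 1 / (N : ℝ) ≤ 1 / 3 := by gcongr
        nlinarith
      linarith
    · have h2 := fittingAngle_le (k := 1) hN le_rfl hn.ge
      have h3 := numCollars_mul_fittingAngle (ne_two_of_numCollars hN hn.ge)
      rw [hn] at h3
      push_cast at h3
      have h6 : fittingAngle N ≤ 5.32 * scale N := by
        refine h2.trans ?_
        gcongr
        push_cast
        linarith [sqrt_pi_lt]
      linarith
  · obtain ⟨h1, h2⟩ := halfHeight_bounds_of_numCollars_eq_two hN h hj hj'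
    constructor <;> linarith
  · obtain ⟨h1, h2⟩ := halfHeight_bounds_of_three_le_numCollars hN h hj hj'
    constructor <;> linarith

end

end ZonalEqualArea

/-! ### Chordal distances and the analytic bound for the radius of a cell. -/

namespace ZonalEqualArea

noncomputable section

open Real Finset

theorem dist_sphPoint_sq (φ θ φ' θ' : ℝ) :
    dist (sphPoint φ θ) (sphPoint φ' θ') ^ 2 =
      2 - 2 * (cos φ * cos φ' + sin φ * sin φ' * cos (θ - θ')) := by
  rw [Subtype.dist_eq, EuclideanSpace.dist_eq, sq_sqrt (by positivity)]
  simp only [sphPoint, Fin.sum_univ_three, Real.dist_eq, sq_abs, Matrix.cons_val_zero,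
    Matrix.cons_val_one, Matrix.cons_val, cos_sub]
  linear_combination (sin φ ^ 2) * sin_sq_add_cos_sq θ + sin φ' ^ 2 * sin_sq_add_cos_sq θ' +
    sin_sq_add_cos_sq φ + sin_sq_add_cos_sq φ'

theorem dist_sphPoint_sq' (φ θ φ' θ' : ℝ) :
    dist (sphPoint φ θ) (sphPoint φ' θ') ^ 2 =
      4 * sin ((φ - φ') / 2) ^ 2 + 4 * (sin φ * sin φ') * sin ((θ - θ') / 2) ^ 2 := by
  have h1 : cos (φ - φ') = 1 - 2 * sin ((φ - φ') / 2) ^ 2 := by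
    rw [← cos_sq_add_sin_sq ((φ - φ') / 2)]
    nth_rw 1 [show φ - φ' = 2 * ((φ - φ') / 2) by ring]
    rw [cos_two_mul']
    ring
  have h2 : cos (θ - θ') = 1 - 2 * sin ((θ - θ') / 2) ^ 2 := by
    rw [← cos_sq_add_sin_sq ((θ - θ') / 2)]
    nth_rw 1 [show θ - θ' = 2 * ((θ - θ') / 2) by ring]
    rw [cos_two_mul']
    ring
  rw [dist_sphPoint_sq, h2]
  rw [cos_sub] at h1
  linear_combination (-2) * h1

theorem dist_le_two (x y : S2) : dist x y ≤ 2 := by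
  have hx := mem_sphere_zero_iff_norm.1 x.2
  have hy := mem_sphere_zero_iff_norm.1 y.2
  rw [Subtype.dist_eq]
  refine (dist_le_norm_add_norm _ _).trans ?_
  rw [hx, hy]
  norm_num

theorem sphPoint_add_two_pi_mul (φ θ : ℝ) (k : ℤ) : sphPoint φ (θ + k * (2 * π)) = sphPoint φ θ := by
  simp only [sphPoint, cos_add_int_mul_two_pi, sin_add_int_mul_two_pi]

theorem exists_eq_sphPoint (y : S2) : ∃ φ ∈ Set.Icc 0 π, ∃ θ, y = sphPoint φ θ := by
  obtain ⟨y, hy⟩ := y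
  have h : y 0 ^ 2 + y 1 ^ 2 + y 2 ^ 2 = 1 := by
    have := mem_sphere_zero_iff_norm.1 hy
    rw [EuclideanSpace.norm_eq, sqrt_eq_one] at this
    simpa [Fin.sum_univ_three] using this
  have h2 : y 2 ∈ Set.Icc (-1 : ℝ) 1 := abs_le.1 (abs_le_one_iff_mul_self_le_one.2 (by nlinarith))
  refine ⟨arccos (y 2), ⟨arccos_nonneg _, arccos_le_pi _⟩, (⟨y 0, y 1⟩ : ℂ).arg, ?_⟩
  have h3 : sin (arccos (y 2)) = ‖(⟨y 0, y 1⟩ : ℂ)‖ := by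
    rw [sin_arccos, Complex.norm_def, Complex.normSq_mk]
    congr 1
    linarith
  ext i
  simp only [sphPoint, h3, Complex.norm_mul_cos_arg, Complex.norm_mul_sin_arg, cos_arccos h2.1 h2.2]
  fin_cases i <;> rfl

/-- Concavity of the sine makes sin x / x decreasing. -/
theorem mul_sin_le_mul_sin {x y : ℝ} (hx : 0 < x) (hxy : x ≤ y) (hy : y ≤ π) :
    x * sin y ≤ y * sin x := by
  have hy0 : 0 < y := hx.trans_le hxy
  have hxy' : 0 ≤ 1 - x / y := by
    rw [sub_nonneg, div_le_one hy0]
    exact hxy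
  have h := strictConcaveOn_sin_Icc.concaveOn.2 (⟨le_rfl, pi_pos.le⟩ : (0 : ℝ) ∈ Set.Icc 0 π)
    (⟨hy0.le, hy⟩ : y ∈ Set.Icc 0 π) hxy' (by positivity : 0 ≤ x / y) (by ring)
  simp only [smul_eq_mul, mul_zero, zero_add, sin_zero, div_mul_cancel₀ _ hy0.ne'] at h
  rw [div_mul_eq_mul_div, div_le_iff₀ hy0] at h
  linarith

/-- The relative variation of `sin` over a collar of half height `h` that stays away
from the poles. -/
theorem sin_le_mul_sin_of_abs_sub_le {c h m φ : ℝ} (hc : 0 < c) (hh : 0 ≤ h) (hm : c + h ≤ m)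
    (hm' : c + h ≤ π - m) (hφ : |φ - m| ≤ h) :
    sin φ ≤ (c + 2 * h) / (c + h) * sin m := by
  wlog hφm : m ≤ φ generalizing m φ
  · have := this (m := π - m) (φ := π - φ) hm' (by linarith)
      (by rw [abs_sub_comm]; simpa using hφ) (by linarith)
    rwa [sin_pi_sub, sin_pi_sub] at this
  have hφ' := (abs_le.1 hφ).2
  have h1 := mul_sin_le_mul_sin (x := m) (y := φ) (by linarith) hφm (by linarith)
  have hm0 : 0 < m := by linarith
  have hs : 0 ≤ sin m := sin_nonneg_of_nonneg_of_le_pi hm0.le (by linarith)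
  rw [div_mul_eq_mul_div, le_div_iff₀ (by positivity)]
  refine le_of_mul_le_mul_left ?_ hm0
  calc m * (sin φ * (c + h)) = (m * sin φ) * (c + h) := by ring
    _ ≤ (φ * sin m) * (c + h) := by gcongr
    _ ≤ ((m + h) * sin m) * (c + h) := by gcongr; linarith
    _ = sin m * ((m + h) * (c + h)) := by ring
    _ ≤ sin m * (m * (c + 2 * h)) := by
        refine mul_le_mul_of_nonneg_left ?_ hs
        -- The right side minus the left side is h (m - c - h).
        nlinarith
    _ = m * ((c + 2 * h) * sin m) := by ring

theorem four_mul_sin_half_sq_le (x : ℝ) : 4 * sin (x / 2) ^ 2 ≤ x ^ 2 := by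
  have := sq_le_sq.2 (abs_sin_le_abs (x := x / 2))
  linarith [show (x / 2) ^ 2 = x ^ 2 / 4 by ring]

theorem dist_sphPoint_sq_le {φ θ m θ' : ℝ} (h : 0 ≤ sin φ * sin m) :
    dist (sphPoint φ θ) (sphPoint m θ') ^ 2 ≤
      (φ - m) ^ 2 + sin φ * sin m * (θ - θ') ^ 2 := by
  rw [dist_sphPoint_sq']
  have h1 := four_mul_sin_half_sq_le (φ - m)
  have h2 := mul_le_mul_of_nonneg_left (four_mul_sin_half_sq_le (θ - θ')) h
  linarith

/-- Replacing sin φ by a multiple of sin m cancels both factors sin m in the squared azimuthal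
width, so the bound depends only on s and h. -/
theorem dist_sphPoint_sq_le_of_mem_cell {s h m φ θ θ' : ℝ} (hs : 0 < s) (hh : 0 < h)
    (hm : 2 * s + h ≤ m) (hm' : 2 * s + h ≤ π - m) (hφ : |φ - m| ≤ h)
    (hθ : |θ - θ'| ≤ π * s ^ 2 / (sin m * sin h)) :
    dist (sphPoint φ θ) (sphPoint m θ') ^ 2 ≤
      h ^ 2 + π ^ 2 * s ^ 4 / sin h ^ 2 * ((2 * s + 2 * h) / (2 * s + h)) := by
  have hφ' := abs_le.1 hφ
  have hsm : 0 < sin m := sin_pos_of_pos_of_lt_pi (by linarith) (by linarith)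
  have hsh : 0 < sin h := sin_pos_of_pos_of_lt_pi hh (by linarith)
  have hsφ : 0 ≤ sin φ := sin_nonneg_of_nonneg_of_le_pi (by linarith) (by linarith)
  have h1 := sin_le_mul_sin_of_abs_sub_le (c := 2 * s) (by positivity) hh.le hm hm' hφ
  have h2 : (φ - m) ^ 2 ≤ h ^ 2 := sq_le_sq' (by linarith) (by linarith)
  have h3 : (θ - θ') ^ 2 ≤ (π * s ^ 2 / (sin m * sin h)) ^ 2 := by
    rw [← sq_abs]
    gcongr
  refine (dist_sphPoint_sq_le (by positivity)).trans (add_le_add h2 ?_)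
  calc sin φ * sin m * (θ - θ') ^ 2
      ≤ ((2 * s + 2 * h) / (2 * s + h) * sin m) * sin m * (π * s ^ 2 / (sin m * sin h)) ^ 2 := by
        gcongr
    _ = _ := by
        field_simp

/-- Setting h = Hs and dividing by s² leaves a polynomial condition on H. Here 12.25 = 3.5², 9.8697
bounds π² and κ is the loss in sin h ≥ κ h. -/
theorem cell_bound_of_polynomial_bound {s h κ : ℝ} {H : ℝ} (hs : 0 < s) (hH : 0 < H)
    (hh : h = H * s) (hκ : 0 < κ) (hsin : κ * h ≤ sin h)
    (hp : 9.8697 * (2 + 2 * H) ≤ (12.25 - H ^ 2) * H ^ 2 * κ ^ 2 * (2 + H)) :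
    h ^ 2 + π ^ 2 * s ^ 4 / sin h ^ 2 * ((2 * s + 2 * h) / (2 * s + h)) ≤ (3.5 * s) ^ 2 := by
  subst hh
  have hπ : π ^ 2 ≤ 9.8697 := by nlinarith [pi_lt_d6, pi_pos]
  have h1 : (2 * s + 2 * (H * s)) / (2 * s + H * s) = (2 + 2 * H) / (2 + H) := by
    field_simp
  have h2 : 0 < κ * (H * s) := by positivity
  calc (H * s) ^ 2 + π ^ 2 * s ^ 4 / sin (H * s) ^ 2 * ((2 * s + 2 * (H * s)) / (2 * s + H * s))
      ≤ (H * s) ^ 2 + 9.8697 * s ^ 4 / (κ * (H * s)) ^ 2 * ((2 + 2 * H) / (2 + H)) := by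
        rw [h1]
        gcongr
    _ = s ^ 2 * (H ^ 2 + (9.8697 * (2 + 2 * H)) / (H ^ 2 * κ ^ 2 * (2 + H))) := by
        field_simp
    _ ≤ s ^ 2 * (H ^ 2 + (12.25 - H ^ 2)) := by
        gcongr
        rw [div_le_iff₀ (by positivity)]
        linarith
    _ = (3.5 * s) ^ 2 := by ring

/-- The factors 0.969, 0.9409, 0.9 and 0.7744 in this lemma and the next three are at most κ² for
the values of κ chosen in `cell_bound`. -/
theorem cell_polynomial_bound_small {H : ℝ} (h1 : 1.137 ≤ H) (h2 : H ≤ 1.25) :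
    9.8697 * (2 + 2 * H) ≤ (12.25 - H ^ 2) * H ^ 2 * 0.969 * (2 + H) := by
  nlinarith [mul_nonneg (sub_nonneg.2 h1) (sub_nonneg.2 h2),
    mul_nonneg (mul_nonneg (sub_nonneg.2 h1) (sub_nonneg.2 h2)) (sq_nonneg H),
    mul_nonneg (mul_nonneg (sub_nonneg.2 h1) (sub_nonneg.2 h2)) (by linarith : 0 ≤ H)]

theorem cell_polynomial_bound_small' {H : ℝ} (h1 : 1.159 ≤ H) (h2 : H ≤ 1.25) :
    9.8697 * (2 + 2 * H) ≤ (12.25 - H ^ 2) * H ^ 2 * 0.9409 * (2 + H) := by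
  nlinarith [mul_nonneg (sub_nonneg.2 h1) (sub_nonneg.2 h2),
    mul_nonneg (mul_nonneg (sub_nonneg.2 h1) (sub_nonneg.2 h2)) (sq_nonneg H),
    mul_nonneg (mul_nonneg (sub_nonneg.2 h1) (sub_nonneg.2 h2)) (by linarith : 0 ≤ H)]

theorem cell_polynomial_bound_medium {H : ℝ} (h1 : 1.25 ≤ H) (h2 : H ≤ 1.6) :
    9.8697 * (2 + 2 * H) ≤ (12.25 - H ^ 2) * H ^ 2 * 0.9 * (2 + H) := by
  nlinarith [mul_nonneg (sub_nonneg.2 h1) (sub_nonneg.2 h2),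
    mul_nonneg (mul_nonneg (sub_nonneg.2 h1) (sub_nonneg.2 h2)) (sq_nonneg H),
    mul_nonneg (mul_nonneg (sub_nonneg.2 h1) (sub_nonneg.2 h2)) (by linarith : 0 ≤ H)]

theorem cell_polynomial_bound_large {H : ℝ} (h1 : 1.6 ≤ H) (h2 : H ≤ 2.42) :
    9.8697 * (2 + 2 * H) ≤ (12.25 - H ^ 2) * H ^ 2 * 0.7744 * (2 + H) := by
  nlinarith [mul_nonneg (sub_nonneg.2 h1) (sub_nonneg.2 h2),
    mul_nonneg (mul_nonneg (sub_nonneg.2 h1) (sub_nonneg.2 h2)) (sq_nonneg H),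
    mul_nonneg (mul_nonneg (sub_nonneg.2 h1) (sub_nonneg.2 h2)) (by linarith : 0 ≤ H)]

theorem mul_le_sin_of_le {s H b c κ : ℝ} (hs : 0 < s) (hH : 0 < H) (hHb : H ≤ b) (hsc : s ≤ c)
    (hκ : κ ≤ 1 - (b * c) ^ 2 / 6) : κ * (H * s) ≤ sin (H * s) := by
  refine le_trans ?_ (sin_ge_sub_cube (by positivity))
  have hb : 0 ≤ b := hH.le.trans hHb
  have h1 : (H * s) ^ 2 ≤ (b * c) ^ 2 := by gcongr
  have h2 : κ ≤ 1 - (H * s) ^ 2 / 6 := by linarith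
  have h3 := mul_le_mul_of_nonneg_right h2 (by positivity : 0 ≤ H * s)
  linarith [show (1 - (H * s) ^ 2 / 6) * (H * s) = H * s - (H * s) ^ 3 / 6 by ring]

/-- The two alternatives are n = 2 and n ≥ 3. The range of H is cut so that 1 - (Hs)²/6 is bounded
below by a suitable κ on each piece; only small H needs a sharp κ. -/
theorem cell_bound {s h : ℝ} (hs : 0 < s)
    (hh : s ≤ 0.3373 ∧ 1.159 * s ≤ h ∨ s ≤ 0.2444 ∧ 1.137 * s ≤ h) (hh' : h ≤ 2.42 * s) :
    h ^ 2 + π ^ 2 * s ^ 4 / sin h ^ 2 * ((2 * s + 2 * h) / (2 * s + h)) ≤ (3.5 * s) ^ 2 := by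
  obtain ⟨H, rfl⟩ : ∃ H, h = H * s := ⟨h / s, by field_simp⟩
  have hs3 : s ≤ 0.3373 := by rcases hh with h | h <;> linarith [h.1]
  have hb : H ≤ 2.42 := le_of_mul_le_mul_right hh' hs
  have ha : 1.137 ≤ H := by
    rcases hh with h | h
    · have := le_of_mul_le_mul_right h.2 hs
      linarith
    · exact le_of_mul_le_mul_right h.2 hs
  have hH : 0 < H := by linarith
  rcases le_total H 1.25 with h1 | h1
  · rcases hh with h | h
    · refine cell_bound_of_polynomial_bound hs hH rfl (κ := 0.97) (by norm_num)
        (mul_le_sin_of_le hs hH h1 h.1 (by norm_num)) ?_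
      convert cell_polynomial_bound_small' (le_of_mul_le_mul_right h.2 hs) h1 using 3
      norm_num
    · refine cell_bound_of_polynomial_bound hs hH rfl (κ := 0.9844) (by norm_num)
        (mul_le_sin_of_le hs hH h1 h.1 (by norm_num)) ?_
      refine (cell_polynomial_bound_small ha h1).trans ?_
      have : 0 ≤ 12.25 - H ^ 2 := by nlinarith
      gcongr
      norm_num
  rcases le_total H 1.6 with h2 | h2
  · refine cell_bound_of_polynomial_bound hs hH rfl (κ := 0.95) (by norm_num)
      (mul_le_sin_of_le hs hH h2 hs3 (by norm_num)) ?_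
    refine (cell_polynomial_bound_medium h1 h2).trans ?_
    have : 0 ≤ 12.25 - H ^ 2 := by nlinarith
    gcongr
    norm_num
  · refine cell_bound_of_polynomial_bound hs hH rfl (κ := 0.88) (by norm_num)
      (mul_le_sin_of_le hs hH hb hs3 (by norm_num)) ?_
    convert cell_polynomial_bound_large h2 hb using 3
    norm_num

end

end ZonalEqualArea

/-! ### Cell counts, distances within a cell and the covering radius. -/

namespace ZonalEqualArea

noncomputable section

open Real Finset

/-- The polar angle midway between `latitude N j` and `latitude N (j + 1)`. -/
def collarMid (N j : ℕ) : ℝ := (latitude N j + latitude N (j + 1)) / 2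

/-- This is the exact area of the collar, with the difference of cosines turned into a product. -/
theorem numCells_eq_mul_sin {N j : ℕ} (hN : 2 ≤ N) (hj : j + 1 ≤ numCollars N + 2) :
    (numCells N (j + 1) : ℝ) = N * (sin (collarMid N j) * sin (halfHeight N j)) := by
  have h := cos_latitude_sub hN hj
  have hN0 : (N : ℝ) ≠ 0 := by positivity
  rw [cos_sub_cos, show (latitude N j - latitude N (j + 1)) / 2 = -halfHeight N j by
    unfold halfHeight; ring, sin_neg] at h
  unfold collarMid
  field_simp at h
  linarith

theorem collarMid_sub_halfHeight (N j : ℕ) : collarMid N j - halfHeight N j = latitude N j := by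
  unfold collarMid halfHeight
  ring

theorem collarMid_add_halfHeight (N j : ℕ) :
    collarMid N j + halfHeight N j = latitude N (j + 1) := by
  unfold collarMid halfHeight
  ring

theorem two_mul_scale_le_latitude {N j : ℕ} (hN : 2 ≤ N) (hj : 1 ≤ j)
    (hj' : j ≤ numCollars N + 1) : 2 * scale N ≤ latitude N j := by
  refine (two_mul_scale_le_capAngle hN).trans ?_
  rw [← latitude_one hN]
  exact latitude_mono hN hj (by omega)

theorem latitude_le_pi_sub {N j : ℕ} (hN : 2 ≤ N) (hj' : j ≤ numCollars N + 1) :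
    latitude N j ≤ π - 2 * scale N := by
  have h1 := two_mul_scale_le_capAngle hN
  have h2 := latitude_mono hN hj' (by omega)
  rw [latitude_numCollars_add_one hN] at h2
  linarith

theorem le_collarMid {N j : ℕ} (hN : 2 ≤ N) (hj : 1 ≤ j) (hj' : j ≤ numCollars N) :
    2 * scale N + halfHeight N j ≤ collarMid N j := by
  have := two_mul_scale_le_latitude hN hj (by omega)
  linarith [collarMid_sub_halfHeight N j]

theorem le_pi_sub_collarMid {N j : ℕ} (hN : 2 ≤ N) (hj' : j ≤ numCollars N) :
    2 * scale N + halfHeight N j ≤ π - collarMid N j := by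
  have := latitude_le_pi_sub (j := j + 1) hN (by omega)
  linarith [collarMid_add_halfHeight N j]

theorem halfHeight_pos {N j : ℕ} (hN : 2 ≤ N) (hj : 1 ≤ j) (hj' : j ≤ numCollars N) :
    0 < halfHeight N j := by
  have h1 := (halfHeight_bounds hN hj hj').1
  have h2 := scale_pos hN
  linarith

theorem sin_collarMid_pos {N j : ℕ} (hN : 2 ≤ N) (hj : 1 ≤ j) (hj' : j ≤ numCollars N) :
    0 < sin (collarMid N j) := by
  have h1 := le_collarMid hN hj hj'
  have h2 := le_pi_sub_collarMid hN hj'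
  have h3 := halfHeight_pos hN hj hj'
  have h4 := scale_pos hN
  exact sin_pos_of_pos_of_lt_pi (by linarith) (by linarith)

theorem sin_halfHeight_pos {N j : ℕ} (hN : 2 ≤ N) (hj : 1 ≤ j) (hj' : j ≤ numCollars N) :
    0 < sin (halfHeight N j) := by
  have h1 := le_collarMid hN hj hj'
  have h2 := le_pi_sub_collarMid hN hj'
  have h3 := halfHeight_pos hN hj hj'
  have h4 := scale_pos hN
  exact sin_pos_of_pos_of_lt_pi (by linarith) (by linarith)

theorem numCells_pos {N j : ℕ} (hN : 2 ≤ N) (hj : 1 ≤ j) (hj' : j ≤ numCollars N) :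
    0 < numCells N (j + 1) := by
  have h := numCells_eq_mul_sin (j := j) hN (by omega)
  have h1 := sin_collarMid_pos hN hj hj'
  have h2 := sin_halfHeight_pos hN hj hj'
  have h3 : (0 : ℝ) < numCells N (j + 1) := by
    rw [h]
    positivity
  exact_mod_cast h3

theorem pi_div_numCells {N j : ℕ} (hN : 2 ≤ N) (hj' : j ≤ numCollars N) :
    π / numCells N (j + 1) =
      π * scale N ^ 2 / (sin (collarMid N j) * sin (halfHeight N j)) := by
  rw [numCells_eq_mul_sin hN (by omega), scale_sq]
  field_simp

theorem cellCenter_one (N : ℕ) (θ : ℕ → ℝ) (k : ℕ) : cellCenter N θ 1 k = sphPoint 0 0 := by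
  simp [cellCenter]

theorem cellCenter_last (N : ℕ) (θ : ℕ → ℝ) (k : ℕ) :
    cellCenter N θ (numCollars N + 2) k = sphPoint π 0 := by
  simp [cellCenter]

theorem cellCenter_succ {N j : ℕ} (θ : ℕ → ℝ) (k : ℕ) (hj : 1 ≤ j) (hj' : j ≤ numCollars N) :
    cellCenter N θ (j + 1) k = sphPoint (collarMid N j)
      (θ (j + 1) + (k + 1 / 2) * (2 * π / numCells N (j + 1))) := by
  rw [cellCenter, if_neg (by omega), if_neg (by omega), Nat.add_sub_cancel, collarMid]
  congr 1
  ring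

theorem mem_zonalConfig {N : ℕ} {θ : ℕ → ℝ} {x : S2} :
    x ∈ zonalConfig N θ ↔ ∃ j ∈ Icc 1 (numCollars N + 2), ∃ k < numCells N j,
      cellCenter N θ j k = x := by
  simp only [zonalConfig, Finset.mem_biUnion, Finset.mem_image, Finset.mem_range]

theorem north_mem_zonalConfig (N : ℕ) (θ : ℕ → ℝ) : sphPoint 0 0 ∈ zonalConfig N θ :=
  mem_zonalConfig.2 ⟨1, by simp, 0, by simp [numCells_one], cellCenter_one N θ 0⟩

theorem south_mem_zonalConfig (N : ℕ) (θ : ℕ → ℝ) : sphPoint π 0 ∈ zonalConfig N θ :=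
  mem_zonalConfig.2 ⟨numCollars N + 2, by simp, 0, by simp [numCells_last],
    cellCenter_last N θ 0⟩

/-- The single collar is symmetric about the equator and has N - 2 cells. For N ≤ 6 a cell reaches
at most a quarter turn from its center, so the squared distance is at most 2 ≤ 12.25/N. For N ≥ 7
the two terms are at most 2.66²/N and 5/N, and 2.66² + 5 < 12.25. -/
theorem dist_sphPoint_sq_le_of_numCollars_eq_one {N : ℕ} {φ θ θ' : ℝ} (hN : 4 ≤ N)
    (hn : numCollars N = 1) (hφ : |φ - π / 2| ≤ halfHeight N 1)
    (hθ : |θ - θ'| ≤ π / numCells N 2) :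
    dist (sphPoint φ θ) (sphPoint (π / 2) θ') ^ 2 ≤ (3.5 * scale N) ^ 2 := by
  have hN2 : 2 ≤ N := by omega
  have hs := scale_pos hN2
  have hh := halfHeight_of_numCollars_eq_one hN2 hn
  have hN0 : (4 : ℝ) ≤ N := by exact_mod_cast hN
  have hφ' := abs_le.1 hφ
  have hφs : 0 ≤ sin φ := by
    have := capAngle_nonneg N
    exact sin_nonneg_of_nonneg_of_le_pi (by linarith) (by linarith)
  have hy : (numCells N 2 : ℝ) = N - 2 := by
    rw [numCells_eq_mul_sin (j := 1) hN2 (by omega), sin_halfHeight_of_numCollars_eq_one hN2 hn,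
      collarMid, latitude_one hN2, show 1 + 1 = numCollars N + 1 by omega,
      latitude_numCollars_add_one hN2, show (capAngle N + (π - capAngle N)) / 2 = π / 2 by ring,
      sin_pi_div_two]
    field_simp
  rw [mul_pow, scale_sq]
  rcases le_or_gt N 6 with h6 | h6
  · have h6' : (N : ℝ) ≤ 6 := by exact_mod_cast h6
    have hθ' : |θ - θ'| ≤ π / 2 := by
      refine hθ.trans ?_
      rw [hy]
      have := pi_pos
      gcongr
      linarith
    have hc : 0 ≤ cos (θ - θ') := by
      have := abs_le.1 hθ'
      exact cos_nonneg_of_neg_pi_div_two_le_of_le this.1 this.2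
    rw [dist_sphPoint_sq, cos_pi_div_two, sin_pi_div_two]
    have h1 : 2 ≤ 3.5 ^ 2 * (1 / (N : ℝ)) := by
      rw [mul_one_div, le_div_iff₀ (by linarith)]
      linarith
    have := mul_nonneg hφs hc
    linarith
  · have h7 : (7 : ℝ) ≤ N := by exact_mod_cast h6
    have h1 := dist_sphPoint_sq_le (φ := φ) (θ := θ) (m := π / 2) (θ' := θ')
      (by rw [sin_pi_div_two, mul_one]; exact hφs)
    refine h1.trans ?_
    rw [sin_pi_div_two, mul_one]
    have h2 := (halfHeight_bounds (j := 1) hN2 le_rfl hn.ge).2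
    have h3 : (φ - π / 2) ^ 2 ≤ (2.66 * scale N) ^ 2 := by
      rw [← sq_abs]
      gcongr
      exact hφ.trans h2
    have h4 : (θ - θ') ^ 2 ≤ (π / (N - 2)) ^ 2 := by
      rw [← sq_abs, ← hy]
      gcongr
    have h5 : sin φ * (θ - θ') ^ 2 ≤ 1 * (π / (N - 2)) ^ 2 := by
      gcongr
      exact sin_le_one φ
    have h8 : (π / (N - 2)) ^ 2 ≤ 5 * (1 / (N : ℝ)) := by
      rw [div_pow, mul_one_div, div_le_div_iff₀ (by nlinarith) (by linarith)]
      have : π ^ 2 ≤ 10 := by nlinarith [pi_lt_d6, pi_pos]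
      nlinarith
    rw [mul_pow, scale_sq] at h3
    have : 0 < 1 / (N : ℝ) := by positivity
    linarith

/-- Every point of a cell is close to the center of the cell. -/
theorem dist_cellCenter_le {N j k : ℕ} {θ : ℕ → ℝ} {φ t : ℝ} (hN : 4 ≤ N) (hj : 1 ≤ j)
    (hj' : j ≤ numCollars N) (hφ : φ ∈ Set.Icc (latitude N j) (latitude N (j + 1)))
    (ht : |t - (θ (j + 1) + (k + 1 / 2) * (2 * π / numCells N (j + 1)))| ≤
      π / numCells N (j + 1)) :
    dist (sphPoint φ t) (cellCenter N θ (j + 1) k) ≤ 3.5 * scale N := by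
  have hN2 : 2 ≤ N := by omega
  have hs := scale_pos hN2
  refine abs_le_of_sq_le_sq' (b := 3.5 * scale N) ?_ (by positivity) |>.2
  rw [cellCenter_succ θ k hj hj']
  have hφm : |φ - collarMid N j| ≤ halfHeight N j := by
    rw [abs_le]
    have h1 := collarMid_sub_halfHeight N j
    have h2 := collarMid_add_halfHeight N j
    constructor <;> linarith [hφ.1, hφ.2]
  rcases lt_trichotomy (numCollars N) 2 with h | h | h
  · have hn : numCollars N = 1 := by omega
    obtain rfl : j = 1 := by omega
    have hm : collarMid N 1 = π / 2 := by
      rw [collarMid, latitude_one hN2, show 1 + 1 = numCollars N + 1 by omega,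
        latitude_numCollars_add_one hN2]
      ring
    rw [hm] at hφm ⊢
    exact dist_sphPoint_sq_le_of_numCollars_eq_one hN hn hφm ht
  · obtain ⟨h1, h2⟩ := halfHeight_bounds_of_numCollars_eq_two hN2 h hj hj'
    rw [pi_div_numCells hN2 hj'] at ht
    exact (dist_sphPoint_sq_le_of_mem_cell hs (halfHeight_pos hN2 hj hj') (le_collarMid hN2 hj hj')
      (le_pi_sub_collarMid hN2 hj') hφm ht).trans
      (cell_bound hs (Or.inl ⟨scale_le_of_numCollars_two hN2 h.ge, h1⟩) h2)
  · obtain ⟨h1, h2⟩ := halfHeight_bounds_of_three_le_numCollars hN2 h hj hj'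
    rw [pi_div_numCells hN2 hj'] at ht
    exact (dist_sphPoint_sq_le_of_mem_cell hs (halfHeight_pos hN2 hj hj') (le_collarMid hN2 hj hj')
      (le_pi_sub_collarMid hN2 hj') hφm ht).trans
      (cell_bound hs (Or.inr ⟨scale_le_of_numCollars_three hN2 h, h1⟩) h2)

theorem dist_north_le {N : ℕ} {φ t : ℝ} (hN : 2 ≤ N) (hφ : 0 ≤ φ) (hφ' : φ ≤ capAngle N) :
    dist (sphPoint φ t) (sphPoint 0 0) ≤ 2 * scale N := by
  have hs := scale_pos hN
  refine abs_le_of_sq_le_sq' (b := 2 * scale N) ?_ (by positivity) |>.2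
  rw [dist_sphPoint_sq, mul_pow, scale_sq, cos_zero, sin_zero]
  have := cos_le_cos_of_nonneg_of_le_pi hφ (arccos_le_pi _) hφ'
  rw [show arccos (1 - 2 / (N : ℝ)) = capAngle N from rfl, cos_capAngle hN] at this
  rw [show 2 / (N : ℝ) = 2 * (1 / N) by ring] at this
  linarith

theorem dist_south_le {N : ℕ} {φ t : ℝ} (hN : 2 ≤ N) (hφ : φ ≤ π) (hφ' : π - capAngle N ≤ φ) :
    dist (sphPoint φ t) (sphPoint π 0) ≤ 2 * scale N := by
  have h := dist_north_le (N := N) (φ := π - φ) (t := t) hN (by linarith) (by linarith)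
  refine le_trans (le_of_eq ?_) h
  rw [← sq_eq_sq₀ dist_nonneg dist_nonneg, dist_sphPoint_sq, dist_sphPoint_sq]
  simp

theorem exists_mem_Icc_succ {f : ℕ → ℝ} {x : ℝ} {a b : ℕ} (hab : a ≤ b) (ha : f a ≤ x)
    (hb : x ≤ f (b + 1)) : ∃ j, a ≤ j ∧ j ≤ b ∧ x ∈ Set.Icc (f j) (f (j + 1)) := by
  induction b, hab using Nat.le_induction with
  | base => exact ⟨a, le_rfl, le_rfl, ha, hb⟩
  | succ b hab ih =>
    rcases le_total x (f (b + 1)) with h | h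
    · obtain ⟨j, h1, h2, h3⟩ := ih h
      exact ⟨j, h1, by omega, h3⟩
    · exact ⟨b + 1, by omega, le_rfl, h, hb⟩

/-- Up to a full turn, every angle lies in one of `n` equal sectors. -/
theorem exists_abs_sub_le_pi_div {n : ℕ} (hn : 0 < n) (θ₀ t : ℝ) :
    ∃ k < n, ∃ m : ℤ, |t + m * (2 * π) - (θ₀ + (k + 1 / 2) * (2 * π / n))| ≤ π / n := by
  have hn0 : (0 : ℝ) < n := by exact_mod_cast hn
  have hπ := pi_pos
  set u := (t - θ₀) / (2 * π) with hu
  have ht : t = θ₀ + 2 * π * (⌊u⌋ + Int.fract u) := by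
    rw [Int.floor_add_fract, hu]
    field_simp
    ring
  have hf0 : 0 ≤ Int.fract u * n := mul_nonneg (Int.fract_nonneg u) hn0.le
  have hf1 : Int.fract u * n < n := mul_lt_of_lt_one_left hn0 (Int.fract_lt_one u)
  refine ⟨⌊Int.fract u * n⌋₊, (Nat.floor_lt hf0).2 hf1, -⌊u⌋, ?_⟩
  have h1 := Nat.floor_le hf0
  have h2 := Nat.lt_floor_add_one (Int.fract u * n)
  have h3 : t + ((-⌊u⌋ : ℤ) : ℝ) * (2 * π) -
      (θ₀ + ((⌊Int.fract u * n⌋₊ : ℝ) + 1 / 2) * (2 * π / n)) =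
      π / n * (2 * (Int.fract u * n - ⌊Int.fract u * n⌋₊) - 1) := by
    rw [ht]
    push_cast
    field_simp
    ring
  rw [h3, abs_mul, abs_of_pos (by positivity)]
  refine mul_le_of_le_one_right (by positivity) ?_
  rw [abs_le]
  constructor <;> linarith

theorem two_le_scale_of_le_three {N : ℕ} (hN : 2 ≤ N) (hN' : N ≤ 3) : 2 ≤ 3.5 * scale N := by
  have hs := scale_pos hN
  have h1 := natCast_mul_scale_sq hN
  have h2 : (N : ℝ) ≤ 3 := by exact_mod_cast hN'
  have h3 : 1 ≤ 3 * scale N ^ 2 := by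
    rw [← h1]
    gcongr
  nlinarith

theorem exists_mem_zonalConfig_dist_le {N : ℕ} (hN : 2 ≤ N) (θ : ℕ → ℝ) (y : S2) :
    ∃ x ∈ zonalConfig N θ, dist y x ≤ 3.5 * scale N := by
  have hs := scale_pos hN
  rcases le_or_gt N 3 with h3 | h3
  -- For N ≤ 3 the bound 3.5/√N exceeds the diameter of the sphere.
  · exact ⟨_, north_mem_zonalConfig N θ,
      (dist_le_two _ _).trans (two_le_scale_of_le_three hN h3)⟩
  obtain ⟨φ, hφ, t, rfl⟩ := exists_eq_sphPoint y
  rcases le_total φ (capAngle N) with h1 | h1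
  · exact ⟨_, north_mem_zonalConfig N θ, (dist_north_le hN hφ.1 h1).trans (by linarith)⟩
  rcases le_total (π - capAngle N) φ with h2 | h2
  · exact ⟨_, south_mem_zonalConfig N θ, (dist_south_le hN hφ.2 h2).trans (by linarith)⟩
  rw [← latitude_one hN] at h1
  rw [← latitude_numCollars_add_one hN] at h2
  obtain ⟨j, hj, hj', hφj⟩ := exists_mem_Icc_succ (one_le_numCollars (by omega)) h1 h2
  obtain ⟨k, hk, m, hm⟩ := exists_abs_sub_le_pi_div (numCells_pos hN hj hj') (θ (j + 1)) t
  refine ⟨_, mem_zonalConfig.2 ⟨j + 1, by simp; omega, k, hk, rfl⟩, ?_⟩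
  rw [← sphPoint_add_two_pi_mul φ t m]
  exact dist_cellCenter_le h3 hj hj' hφj hm

theorem coveringRadius_zonalConfig_le {N : ℕ} (hN : 2 ≤ N) (θ : ℕ → ℝ) :
    coveringRadius (zonalConfig N θ) ≤ 3.5 * scale N := by
  have : Nonempty S2 := ⟨sphPoint 0 0⟩
  refine ciSup_le fun y => ?_
  obtain ⟨x, hx, hxy⟩ := exists_mem_zonalConfig_dist_le hN θ y
  exact (Metric.infDist_le_dist_of_mem hx).trans hxy

/-! ### Separation, number of points and mesh ratio. -/

/-- The polar angle of the centers of the cells of the `j`-th collar. -/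
def centerAngle (N j : ℕ) : ℝ :=
  if j = 1 then 0 else if j = numCollars N + 2 then π else collarMid N (j - 1)

theorem exists_cellCenter_eq (N : ℕ) (θ : ℕ → ℝ) {j : ℕ} (hj : 1 ≤ j) (k : ℕ) :
    ∃ t, cellCenter N θ j k = sphPoint (centerAngle N j) t := by
  unfold cellCenter centerAngle
  split_ifs with h1 h2
  · exact ⟨_, rfl⟩
  · exact ⟨_, rfl⟩
  · rw [collarMid, Nat.sub_add_cancel hj]
    exact ⟨_, rfl⟩

theorem centerAngle_mem (N j : ℕ) : centerAngle N j ∈ Set.Icc 0 π := by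
  unfold centerAngle collarMid
  have h1 := latitude_nonneg N
  have h2 := latitude_le_pi N
  have h3 := pi_pos
  split_ifs
  · exact ⟨le_rfl, h3.le⟩
  · exact ⟨h3.le, le_rfl⟩
  · constructor <;> linarith [h1 (j - 1), h2 (j - 1), h1 (j - 1 + 1), h2 (j - 1 + 1)]

theorem centerAngle_add_le {N j : ℕ} (hN : 2 ≤ N) (hj : 1 ≤ j) (hj' : j ≤ numCollars N + 1) :
    centerAngle N j + 1 / 3 * scale N ≤ latitude N j := by
  have hs := scale_pos hN
  rcases hj.eq_or_lt with rfl | h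
  · have := two_mul_scale_le_latitude hN le_rfl hj'
    simp only [centerAngle, if_true]
    linarith
  · obtain ⟨i, rfl⟩ := Nat.exists_eq_add_of_le' hj
    rw [centerAngle, if_neg (by omega), if_neg (by omega), Nat.add_sub_cancel]
    have := (halfHeight_bounds (j := i) hN (by omega) (by omega)).1
    linarith [collarMid_add_halfHeight N i]

theorem latitude_le_centerAngle {N j : ℕ} (hN : 2 ≤ N) (hj : 1 ≤ j)
    (hj' : j ≤ numCollars N + 1) : latitude N j ≤ centerAngle N (j + 1) := by
  rw [centerAngle, if_neg (by omega), Nat.add_sub_cancel]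
  split_ifs with h
  · exact latitude_le_pi N j
  · have := halfHeight_pos hN hj (by omega)
    linarith [collarMid_sub_halfHeight N j]

/-- The southern boundary of the i-th collar separates the two centers, and it is at least s/3 south
of the first one. -/
theorem centerAngle_add_le_centerAngle {N i j : ℕ} (hN : 2 ≤ N) (hi : 1 ≤ i) (hij : i < j)
    (hj : j ≤ numCollars N + 2) : centerAngle N i + 1 / 3 * scale N ≤ centerAngle N j := by
  obtain ⟨l, rfl⟩ := Nat.exists_eq_add_of_le' (hi.trans hij.le)
  exact (centerAngle_add_le hN hi (by omega)).trans ((latitude_mono hN (by omega) (by omega)).trans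
    (latitude_le_centerAngle hN (by omega) (by omega)))

theorem two_mul_sin_le_dist_sphPoint {φ φ' : ℝ} (hφ : φ ∈ Set.Icc 0 π) (hφ' : φ' ∈ Set.Icc 0 π)
    (t t' : ℝ) : 2 * sin ((φ' - φ) / 2) ≤ dist (sphPoint φ t) (sphPoint φ' t') := by
  refine le_of_abs_le (abs_le_of_sq_le_sq ?_ dist_nonneg)
  rw [dist_comm, dist_sphPoint_sq']
  have := mul_nonneg (sin_nonneg_of_mem_Icc hφ') (sin_nonneg_of_mem_Icc hφ)
  have := mul_nonneg this (sq_nonneg (sin ((t' - t) / 2)))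
  linarith [mul_pow 2 (sin ((φ' - φ) / 2)) 2]

theorem le_dist_cellCenter_of_lt {N i j : ℕ} (hN : 2 ≤ N) (θ : ℕ → ℝ) (hi : 1 ≤ i) (hij : i < j)
    (hj : j ≤ numCollars N + 2) (k l : ℕ) :
    0.2 * scale N ≤ dist (cellCenter N θ i k) (cellCenter N θ j l) := by
  have hs := scale_pos hN
  obtain ⟨t, ht⟩ := exists_cellCenter_eq N θ hi k
  obtain ⟨t', ht'⟩ := exists_cellCenter_eq N θ (hi.trans hij.le) l
  rw [ht, ht']
  have hi' := centerAngle_mem N i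
  have hj' := centerAngle_mem N j
  refine le_trans ?_ (two_mul_sin_le_dist_sphPoint hi' hj' t t')
  have h1 := centerAngle_add_le_centerAngle hN hi hij hj
  have h2 := mul_le_sin (x := (centerAngle N j - centerAngle N i) / 2) (by linarith)
    (by linarith [hi'.1, hj'.2])
  have h3 : (0.6 : ℝ) ≤ 2 / π := by
    rw [le_div_iff₀ pi_pos]
    linarith [pi_lt_d4]
  have h4 : 0.6 * (1 / 6 * scale N) ≤ 2 / π * ((centerAngle N j - centerAngle N i) / 2) := by
    gcongr
    linarith
  linarith

/-- The angle iπ/n has distance at least π/n from 0 and π, so Jordan's inequality applies. -/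
theorem two_div_le_sin_mul_pi_div {i n : ℕ} (hi : 0 < i) (hin : i < n) :
    2 / n ≤ sin (i * (π / n)) := by
  have hn : (0 : ℝ) < n := by exact_mod_cast hi.trans hin
  have hi1 : (1 : ℝ) ≤ i := by exact_mod_cast hi
  have hin1 : (i : ℝ) + 1 ≤ n := by exact_mod_cast hin
  have hπ := pi_pos
  have h0 : 0 < π / n := by positivity
  have h2 : (n : ℝ) * (π / n) = π := by field_simp
  have h1 := min_le_sin (x := i * (π / n)) (c := π / n) (by nlinarith) (by nlinarith)
    ⟨by positivity, by nlinarith⟩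
  refine le_trans (le_of_eq ?_) h1
  field_simp

/-- The chord is at least 4 sin m / y_j = 4/(N sin h). The factor sin m cancels, so collars near the
poles are no worse, and sin h ≤ 2.66 s finishes. -/
theorem le_dist_cellCenter_succ_of_lt {N j k l : ℕ} (hN : 2 ≤ N) (θ : ℕ → ℝ) (hj : 1 ≤ j)
    (hj' : j ≤ numCollars N) (hkl : l < k) (hk : k < numCells N (j + 1)) :
    0.2 * scale N ≤ dist (cellCenter N θ (j + 1) k) (cellCenter N θ (j + 1) l) := by
  have hs := scale_pos hN
  rw [cellCenter_succ θ k hj hj', cellCenter_succ θ l hj hj']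
  have hm := sin_collarMid_pos hN hj hj'
  have hh := sin_halfHeight_pos hN hj hj'
  have hh' := halfHeight_bounds hN hj hj'
  have hc := natCast_mul_scale_sq hN
  have hN0 : (0 : ℝ) < N := by positivity
  have h1 := two_div_le_sin_mul_pi_div (i := k - l) (n := numCells N (j + 1)) (by omega) (by omega)
  rw [Nat.cast_sub hkl.le] at h1
  have h2 : 4 / (N * sin (halfHeight N j)) ≤
      2 * (sin (collarMid N j) * sin (((k : ℝ) - l) * (π / numCells N (j + 1)))) := by
    calc 4 / (N * sin (halfHeight N j))
        = 2 * (sin (collarMid N j) * (2 / numCells N (j + 1))) := by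
          rw [numCells_eq_mul_sin hN (by omega)]
          field_simp
          norm_num
      _ ≤ _ := by gcongr
  refine le_trans ?_ (h2.trans ?_)
  · rw [le_div_iff₀ (by positivity)]
    have h3 : sin (halfHeight N j) ≤ 2.66 * scale N :=
      (sin_le (halfHeight_pos hN hj hj').le).trans hh'.2
    calc 0.2 * scale N * (N * sin (halfHeight N j))
        ≤ 0.2 * scale N * (N * (2.66 * scale N)) := by gcongr
      _ = 0.532 * (N * scale N ^ 2) := by ring
      _ ≤ 4 := by rw [hc]; norm_num
  · refine le_of_abs_le (abs_le_of_sq_le_sq ?_ dist_nonneg)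
    rw [dist_sphPoint_sq', sub_self, zero_div, sin_zero]
    refine le_of_eq ?_
    rw [show (θ (j + 1) + ((k : ℝ) + 1 / 2) * (2 * π / numCells N (j + 1)) -
      (θ (j + 1) + ((l : ℝ) + 1 / 2) * (2 * π / numCells N (j + 1)))) / 2 =
      ((k : ℝ) - l) * (π / numCells N (j + 1)) by ring]
    ring

/-- Centers of different cells are well separated. -/
theorem le_dist_cellCenter {N i j k l : ℕ} (hN : 2 ≤ N) (θ : ℕ → ℝ)
    (hi : i ∈ Icc 1 (numCollars N + 2)) (hj : j ∈ Icc 1 (numCollars N + 2))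
    (hk : k < numCells N i) (hl : l < numCells N j) (h : i ≠ j ∨ k ≠ l) :
    0.2 * scale N ≤ dist (cellCenter N θ i k) (cellCenter N θ j l) := by
  rw [Finset.mem_Icc] at hi hj
  rcases lt_trichotomy i j with hij | rfl | hij
  · exact le_dist_cellCenter_of_lt hN θ hi.1 hij hj.2 k l
  · have hkl : k ≠ l := h.resolve_left (by simp)
    have h1 : i ≠ 1 := by
      rintro rfl
      rw [numCells_one] at hk hl
      omega
    have h2 : i ≠ numCollars N + 2 := by
      rintro rfl
      rw [numCells_last] at hk hl
      omega
    obtain ⟨i, rfl⟩ := Nat.exists_eq_add_of_le' hi.1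
    rcases hkl.lt_or_gt with h3 | h3
    · rw [dist_comm]
      exact le_dist_cellCenter_succ_of_lt hN θ (by omega) (by omega) h3 hl
    · exact le_dist_cellCenter_succ_of_lt hN θ (by omega) (by omega) h3 hk
  · rw [dist_comm]
    exact le_dist_cellCenter_of_lt hN θ hj.1 hij hi.2 l k

theorem cellCenter_injective {N i j k l : ℕ} (hN : 2 ≤ N) (θ : ℕ → ℝ)
    (hi : i ∈ Icc 1 (numCollars N + 2)) (hj : j ∈ Icc 1 (numCollars N + 2))
    (hk : k < numCells N i) (hl : l < numCells N j)
    (h : cellCenter N θ i k = cellCenter N θ j l) : i = j ∧ k = l := by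
  by_contra hne
  have h1 := le_dist_cellCenter hN θ hi hj hk hl (by tauto)
  rw [h, dist_self] at h1
  linarith [scale_pos hN]

/-- Sums over the configuration are sums over the cells. -/
theorem sum_zonalConfig {M : Type*} [AddCommMonoid M] {N : ℕ} (hN : 2 ≤ N) (θ : ℕ → ℝ)
    (f : S2 → M) : ∑ x ∈ zonalConfig N θ, f x =
      ∑ j ∈ Icc 1 (numCollars N + 2), ∑ k ∈ range (numCells N j), f (cellCenter N θ j k) := by
  classical
  have hdef : zonalConfig N θ = (Icc 1 (numCollars N + 2)).biUnion fun j =>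
      (range (numCells N j)).image fun k => cellCenter N θ j k := by
    ext x
    simp only [mem_zonalConfig, Finset.mem_biUnion, Finset.mem_image, Finset.mem_range]
  rw [hdef, Finset.sum_biUnion]
  · refine Finset.sum_congr rfl fun j hj => Finset.sum_image fun k hk l hl h => ?_
    exact (cellCenter_injective hN θ hj hj (by simpa using hk) (by simpa using hl) h).2
  · intro i hi j hj hij
    refine Finset.disjoint_left.2 fun x hx hx' => hij ?_
    simp only [Finset.mem_image, Finset.mem_range] at hx hx'
    obtain ⟨k, hk, rfl⟩ := hx
    obtain ⟨l, hl, h⟩ := hx'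
    exact (cellCenter_injective hN θ hj hi hl hk h).1.symm

theorem card_zonalConfig {N : ℕ} (hN : 2 ≤ N) (θ : ℕ → ℝ) : (zonalConfig N θ).card = N := by
  rw [Finset.card_eq_sum_ones, sum_zonalConfig hN]
  simpa using sum_numCells hN

theorem le_separation_zonalConfig {N : ℕ} (hN : 2 ≤ N) (θ : ℕ → ℝ) :
    0.2 * scale N ≤ separation (zonalConfig N θ) := by
  -- `Set.infsep` is 0 on a set with at most one point, so a second point is needed.
  have hnt : (zonalConfig N θ).Nontrivial := by
    rw [← Finset.one_lt_card_iff_nontrivial, card_zonalConfig hN]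
    exact hN
  refine Set.Nontrivial.le_infsep hnt fun x hx y hy hxy => ?_
  obtain ⟨i, hi, k, hk, rfl⟩ := mem_zonalConfig.1 (Finset.mem_coe.1 hx)
  obtain ⟨j, hj, l, hl, rfl⟩ := mem_zonalConfig.1 (Finset.mem_coe.1 hy)
  refine le_dist_cellCenter hN θ hi hj hk hl ?_
  by_contra! h
  exact hxy (by rw [h.1, h.2])

theorem meshRatio_zonalConfig_le {N : ℕ} (hN : 2 ≤ N) (θ : ℕ → ℝ) :
    meshRatio (zonalConfig N θ) ≤ 17.5 := by
  have hs := scale_pos hN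
  have h1 := le_separation_zonalConfig hN θ
  rw [meshRatio, div_le_iff₀ (by linarith)]
  linarith [coveringRadius_zonalConfig_le hN θ]

end

end ZonalEqualArea

/-! ### Spherical coordinates in ℝ³. -/

namespace ZonalEqualArea

noncomputable section

open Real MeasureTheory Set
open scoped ENNReal

local notation "E3" => EuclideanSpace ℝ (Fin 3)

theorem measurable_vec3 {α : Type*} [MeasurableSpace α] {f g h : α → ℝ} (hf : Measurable f)
    (hg : Measurable g) (hh : Measurable h) :
    Measurable fun a => (!₂[f a, g a, h a] : E3) := by
  refine (PiLp.volume_preserving_toLp (Fin 3)).measurable.comp (measurable_pi_lambda _ fun i => ?_)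
  fin_cases i
  exacts [hf, hg, hh]

theorem measurable_smul_sphPoint {α : Type*} [MeasurableSpace α] {r φ t : α → ℝ}
    (hr : Measurable r) (hφ : Measurable φ) (ht : Measurable t) :
    Measurable fun a => r a • (sphPoint (φ a) (t a) : E3) := by
  have : (fun a => r a • (sphPoint (φ a) (t a) : E3)) =
      fun a => !₂[r a * (sin (φ a) * cos (t a)), r a * (sin (φ a) * sin (t a)),
        r a * cos (φ a)] := by
    ext a i
    fin_cases i <;> rfl
  rw [this]
  exact measurable_vec3 (by fun_prop) (by fun_prop) (by fun_prop)

/-- The coordinate z is split off first, leaving the horizontal plane for polar coordinates. -/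
theorem lintegral_euclideanSpace_three {F : E3 → ℝ≥0∞} (hF : Measurable F) :
    ∫⁻ x, F x = ∫⁻ z : ℝ, ∫⁻ q : ℝ × ℝ, F !₂[q.1, q.2, z] := by
  rw [← (PiLp.volume_preserving_toLp (Fin 3)).lintegral_comp hF]
  have hF' : Measurable fun v : Fin 3 → ℝ => F (WithLp.toLp 2 v) :=
    hF.comp (PiLp.volume_preserving_toLp (Fin 3)).measurable
  have hF'' : Measurable fun a : ℝ × (Fin 2 → ℝ) =>
      F (WithLp.toLp 2 ((MeasurableEquiv.piFinSuccAbove (fun _ : Fin 3 => ℝ) 2).symm a)) :=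
    hF'.comp (MeasurableEquiv.measurable _)
  rw [← ((volume_preserving_piFinSuccAbove (fun _ : Fin 3 => ℝ) 2).symm).lintegral_comp hF',
    Measure.volume_eq_prod, lintegral_prod _ hF''.aemeasurable]
  refine lintegral_congr fun z => ?_
  rw [← ((volume_preserving_finTwoArrow ℝ).symm).lintegral_comp]
  · refine lintegral_congr fun q => ?_
    congr 2
    ext i
    fin_cases i <;> rfl
  · exact hF''.comp measurable_prodMk_left

theorem lintegral_polarCoord {G : ℝ × ℝ → ℝ≥0∞} (hG : Measurable G) :
    ∫⁻ q, G q = ∫⁻ t in Ioo (-π) π, ∫⁻ r in Ioi (0 : ℝ),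
      ENNReal.ofReal r * G (r * cos t, r * sin t) := by
  rw [← lintegral_comp_polarCoord_symm]
  simp only [polarCoord_target, polarCoord_symm_apply, smul_eq_mul]
  rw [Measure.volume_eq_prod, ← Measure.prod_restrict, lintegral_prod_symm]
  refine Measurable.aemeasurable ?_
  refine (ENNReal.measurable_ofReal.comp measurable_fst).mul (hG.comp ?_)
  fun_prop

/-- Integration over `ℝ³` in spherical coordinates. -/
theorem lintegral_spherical {F : E3 → ℝ≥0∞} (hF : Measurable F) :
    ∫⁻ x, F x = ∫⁻ r in Ioi (0 : ℝ), ∫⁻ p in Ioo 0 π ×ˢ Ioo (-π) π,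
      ENNReal.ofReal (r ^ 2 * sin p.1) * F (r • (sphPoint p.1 p.2 : E3)) := by
  have hm1 : ∀ {α : Type} [MeasurableSpace α] {f g h : α → ℝ}, Measurable f → Measurable g →
      Measurable h → Measurable fun a =>
        ENNReal.ofReal (f a) * F !₂[f a * cos (g a), f a * sin (g a), h a] := fun hf hg hh =>
    (ENNReal.measurable_ofReal.comp hf).mul
      (hF.comp (measurable_vec3 (by fun_prop) (by fun_prop) hh))
  have hm2 : ∀ {α : Type} [MeasurableSpace α] {f g h : α → ℝ}, Measurable f → Measurable g →
      Measurable h → Measurable fun a =>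
        ENNReal.ofReal (f a ^ 2 * sin (g a)) * F (f a • (sphPoint (g a) (h a) : E3)) :=
    fun hf hg hh => (ENNReal.measurable_ofReal.comp (by fun_prop)).mul
      (hF.comp (measurable_smul_sphPoint hf hg hh))
  rw [lintegral_euclideanSpace_three hF]
  have h1 : ∀ z : ℝ, ∫⁻ q : ℝ × ℝ, F !₂[q.1, q.2, z] =
      ∫⁻ t in Ioo (-π) π, ∫⁻ ρ in Ioi (0 : ℝ),
        ENNReal.ofReal ρ * F !₂[ρ * cos t, ρ * sin t, z] := fun z =>
    lintegral_polarCoord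
      (hF.comp (measurable_vec3 measurable_fst measurable_snd measurable_const))
  simp_rw [h1]
  rw [lintegral_lintegral_swap]
  swap
  · have : Measurable fun w : (ℝ × ℝ) × ℝ =>
        ENNReal.ofReal w.2 * F !₂[w.2 * cos w.1.2, w.2 * sin w.1.2, w.1.1] :=
      hm1 (by fun_prop) (by fun_prop) (by fun_prop)
    exact (this.lintegral_prod_right' (ν := volume.restrict (Ioi (0 : ℝ)))).aemeasurable
  -- Polar coordinates again, now z = r cos φ and ρ = r sin φ. The indicator of ρ > 0 cuts (-π, π)
  -- down to (0, π), and the Jacobians r and ρ multiply to r² sin φ.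
  have h2 : ∀ t : ℝ, ∫⁻ z : ℝ, ∫⁻ ρ in Ioi (0 : ℝ),
        ENNReal.ofReal ρ * F !₂[ρ * cos t, ρ * sin t, z] =
      ∫⁻ r in Ioi (0 : ℝ), ∫⁻ φ in Ioo 0 π,
        ENNReal.ofReal (r ^ 2 * sin φ) * F (r • (sphPoint φ t : E3)) := by
    intro t
    have hm3 : Measurable fun w : ℝ × ℝ =>
        ENNReal.ofReal w.2 * F !₂[w.2 * cos t, w.2 * sin t, w.1] :=
      hm1 (by fun_prop) (by fun_prop) (by fun_prop)
    have hind : MeasurableSet {w : ℝ × ℝ | 0 < w.2} := measurableSet_lt (by fun_prop) (by fun_prop)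
    have h3 : ∫⁻ z : ℝ, ∫⁻ ρ in Ioi (0 : ℝ),
        ENNReal.ofReal ρ * F !₂[ρ * cos t, ρ * sin t, z] =
        ∫⁻ w : ℝ × ℝ, {w : ℝ × ℝ | 0 < w.2}.indicator
          (fun w => ENNReal.ofReal w.2 * F !₂[w.2 * cos t, w.2 * sin t, w.1]) w := by
      rw [Measure.volume_eq_prod, lintegral_prod _ (hm3.indicator hind).aemeasurable]
      refine lintegral_congr fun z => ?_
      rw [← lintegral_indicator measurableSet_Ioi]
      rfl
    rw [h3, lintegral_polarCoord (hm3.indicator hind), lintegral_lintegral_swap]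
    · refine setLIntegral_congr_fun measurableSet_Ioi fun r hr => ?_
      rw [mem_Ioi] at hr
      have hsub : Ioo 0 π ⊆ Ioo (-π) π := Ioo_subset_Ioo_left (by linarith [pi_pos])
      rw [← lintegral_indicator measurableSet_Ioo, ← lintegral_indicator measurableSet_Ioo]
      refine lintegral_congr fun φ => ?_
      by_cases hφ : φ ∈ Ioo 0 π
      · have hs := sin_pos_of_mem_Ioo hφ
        rw [indicator_of_mem (hsub hφ), indicator_of_mem hφ,
          indicator_of_mem (show (r * cos φ, r * sin φ) ∈ {w : ℝ × ℝ | 0 < w.2} from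
            mul_pos hr hs), ← mul_assoc, ← ENNReal.ofReal_mul hr.le]
        congr 2
        · ring
        · ext i
          fin_cases i <;> simp [sphPoint] <;> ring
      · rw [indicator_of_notMem hφ]
        by_cases hφ' : φ ∈ Ioo (-π) π
        · have hs : ¬ 0 < r * sin φ := by
            have : φ ≤ 0 := by
              by_contra! h
              exact hφ ⟨h, hφ'.2⟩
            have := sin_nonpos_of_nonpos_of_neg_pi_le this hφ'.1.le
            exact not_lt.2 (mul_nonpos_of_nonneg_of_nonpos hr.le this)
          rw [indicator_of_mem hφ', indicator_of_notMem (by exact hs), mul_zero]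
        · rw [indicator_of_notMem hφ']
    · refine Measurable.aemeasurable ?_
      refine (ENNReal.measurable_ofReal.comp measurable_snd).mul ((hm3.indicator hind).comp ?_)
      fun_prop
  simp_rw [h2]
  rw [lintegral_lintegral_swap]
  · refine lintegral_congr fun r => ?_
    rw [Measure.volume_eq_prod, ← Measure.prod_restrict, lintegral_prod_symm]
    exact (hm2 (by fun_prop) (by fun_prop) (by fun_prop)).aemeasurable
  · have : Measurable fun w : (ℝ × ℝ) × ℝ =>
        ENNReal.ofReal (w.1.2 ^ 2 * sin w.2) * F (w.1.2 • (sphPoint w.2 w.1.1 : E3)) :=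
      hm2 (by fun_prop) (by fun_prop) (by fun_prop)
    exact (this.lintegral_prod_right' (ν := volume.restrict (Ioo 0 π))).aemeasurable

end

end ZonalEqualArea

/-! ### The surface measure of the sphere in spherical coordinates. -/

namespace ZonalEqualArea

noncomputable section

open Real MeasureTheory Set
open scoped ENNReal Pointwise

local notation "E3" => EuclideanSpace ℝ (Fin 3)

theorem continuous_sphPoint : Continuous fun p : ℝ × ℝ => sphPoint p.1 p.2 := by
  refine Continuous.subtype_mk ?_ _
  refine (PiLp.continuous_toLp 2 _).comp (continuous_pi fun i => ?_)
  fin_cases i <;> simp <;> fun_prop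

/-- The domain of the spherical coordinates `(φ, θ)`. -/
def sphDomain : Set (ℝ × ℝ) := Ioo 0 π ×ˢ Ioo (-π) π

theorem measurableSet_sphDomain : MeasurableSet sphDomain :=
  measurableSet_Ioo.prod measurableSet_Ioo

/-- The surface area measure in spherical coordinates. -/
def sphDensity : Measure (ℝ × ℝ) :=
  (volume.restrict sphDomain).withDensity fun p => ENNReal.ofReal (sin p.1)

theorem lintegral_sq_Iio_one :
    ∫⁻ r in Ioi (0 : ℝ), (Iio (1 : ℝ)).indicator (fun r => ENNReal.ofReal (r ^ 2)) r =
      ENNReal.ofReal (1 / 3) := by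
  rw [lintegral_indicator measurableSet_Iio, Measure.restrict_restrict measurableSet_Iio,
    inter_comm, Ioi_inter_Iio, Measure.restrict_congr_set Ioo_ae_eq_Ioc,
    ← ofReal_integral_eq_lintegral_ofReal, ← intervalIntegral.integral_of_le zero_le_one]
  · rw [integral_pow]
    norm_num
  · exact ((continuous_pow 2).intervalIntegrable 0 1).1
  · exact Filter.Eventually.of_forall fun r => sq_nonneg r

/-- The cone over s is the preimage of s under radial projection, within the punctured open ball. -/
theorem measurableSet_Ioo_smul_image {s : Set S2} (hs : MeasurableSet s) :
    MeasurableSet (Ioo (0 : ℝ) 1 • ((↑) '' s : Set E3)) := by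
  have h : Ioo (0 : ℝ) 1 • ((↑) '' s : Set E3) =
      {x | ‖x‖ ∈ Ioo 0 1} ∩ (fun x => ‖x‖⁻¹ • x) ⁻¹' ((↑) '' s) := by
    ext x
    constructor
    · rintro ⟨r, hr, _, ⟨u, hu, rfl⟩, rfl⟩
      have hn : ‖r • (u : E3)‖ = r := by
        rw [norm_smul, norm_eq_of_mem_sphere, mul_one, norm_of_nonneg hr.1.le]
      simp only [mem_inter_iff, mem_ofPred_eq, mem_preimage, hn, smul_smul,
        inv_mul_cancel₀ hr.1.ne', one_smul]
      exact ⟨hr, mem_image_of_mem _ hu⟩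
    · rintro ⟨hx, hx'⟩
      refine ⟨‖x‖, hx, _, hx', ?_⟩
      simp only [smul_smul, mul_inv_cancel₀ hx.1.ne', one_smul]
  rw [h]
  have hs' : MeasurableSet ((↑) '' s : Set E3) :=
    Metric.isClosed_sphere.measurableSet.subtype_image hs
  exact (measurable_norm measurableSet_Ioo).inter
    ((measurable_norm.inv.smul measurable_id) hs')

/-- `toSphere` is 3 times the volume of the cone over s. In spherical coordinates the indicator of
the cone splits into r < 1 and a condition on the angles, and 3 ∫₀¹ r² dr = 1. -/
theorem toSphere_eq_map : (volume : Measure E3).toSphere =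
    sphDensity.map fun p => sphPoint p.1 p.2 := by
  ext s hs
  have hmeas := continuous_sphPoint.measurable
  rw [Measure.map_apply hmeas hs, sphDensity, withDensity_apply _ (hmeas hs),
    ← lintegral_indicator (hmeas hs)]
  rw [Measure.toSphere_apply' _ hs]
  have hA := measurableSet_Ioo_smul_image hs
  rw [← lintegral_indicator_one hA, lintegral_spherical (measurable_one.indicator hA)]
  have h1 : ∀ r ∈ Ioi (0 : ℝ), ∀ p : ℝ × ℝ,
      ENNReal.ofReal (r ^ 2 * sin p.1) *
        (Ioo (0 : ℝ) 1 • ((↑) '' s : Set E3)).indicator 1 (r • (sphPoint p.1 p.2 : E3)) =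
      (Iio (1 : ℝ)).indicator (fun r => ENNReal.ofReal (r ^ 2)) r *
        ((fun p : ℝ × ℝ => sphPoint p.1 p.2) ⁻¹' s).indicator
          (fun p => ENNReal.ofReal (sin p.1)) p := by
    intro r hr p
    have hiff : r • (sphPoint p.1 p.2 : E3) ∈ Ioo (0 : ℝ) 1 • ((↑) '' s : Set E3) ↔
        r < 1 ∧ sphPoint p.1 p.2 ∈ s := by
      rw [mem_Ioi] at hr
      constructor
      · rintro ⟨r', hr', _, ⟨u, hu, rfl⟩, h⟩
        have hn := congrArg norm h
        simp only [norm_smul, norm_eq_of_mem_sphere, mul_one, Real.norm_eq_abs,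
          abs_of_pos hr, abs_of_pos hr'.1] at hn
        subst hn
        have : u = sphPoint p.1 p.2 := Subtype.ext (smul_right_injective _ hr.ne' h)
        exact ⟨hr'.2, this ▸ hu⟩
      · rintro ⟨h, h'⟩
        exact smul_mem_smul ⟨hr, h⟩ (mem_image_of_mem _ h')
    classical
    rw [ENNReal.ofReal_mul (sq_nonneg r)]
    simp only [indicator_apply, hiff, mem_preimage, mem_Iio, Pi.one_apply]
    by_cases h2 : r < 1 <;> by_cases h3 : sphPoint p.1 p.2 ∈ s <;> simp [h2, h3]
  have h2 : ∀ r ∈ Ioi (0 : ℝ), ∫⁻ p in Ioo 0 π ×ˢ Ioo (-π) π, ENNReal.ofReal (r ^ 2 * sin p.1) *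
        (Ioo (0 : ℝ) 1 • ((↑) '' s : Set E3)).indicator 1 (r • (sphPoint p.1 p.2 : E3)) =
      (Iio (1 : ℝ)).indicator (fun r => ENNReal.ofReal (r ^ 2)) r *
        ∫⁻ p in sphDomain, ((fun p : ℝ × ℝ => sphPoint p.1 p.2) ⁻¹' s).indicator
          (fun p => ENNReal.ofReal (sin p.1)) p := by
    intro r hr
    rw [← lintegral_const_mul]
    · exact lintegral_congr fun p => h1 r hr p
    · exact (ENNReal.measurable_ofReal.comp (by fun_prop)).indicator (hmeas hs)
  rw [setLIntegral_congr_fun measurableSet_Ioi h2, lintegral_mul_const, lintegral_sq_Iio_one,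
    ← mul_assoc, finrank_euclideanSpace_fin, ← ENNReal.ofReal_natCast, ← ENNReal.ofReal_mul]
  · norm_num
  · norm_num
  · exact (ENNReal.measurable_ofReal.comp (by fun_prop)).indicator measurableSet_Iio

theorem integrable_sin_mul {f : C(S2, ℝ)} :
    IntegrableOn (fun p : ℝ × ℝ => sin p.1 * f (sphPoint p.1 p.2)) (Ioc 0 π ×ˢ Ioc (-π) π) := by
  have h : Continuous fun p : ℝ × ℝ => sin p.1 * f (sphPoint p.1 p.2) :=
    (by fun_prop : Continuous fun p : ℝ × ℝ => sin p.1).mul (f.continuous.comp continuous_sphPoint)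
  exact (h.continuousOn.integrableOn_compact (isCompact_Icc.prod isCompact_Icc)).mono_set
    (prod_mono Ioc_subset_Icc_self Ioc_subset_Icc_self)

theorem integral_toSphere (f : C(S2, ℝ)) :
    ∫ x, f x ∂(volume : Measure E3).toSphere =
      ∫ φ in (0)..π, sin φ * ∫ t in (-π)..π, f (sphPoint φ t) := by
  rw [toSphere_eq_map, integral_map continuous_sphPoint.measurable.aemeasurable
    f.continuous.aestronglyMeasurable, sphDensity,
    integral_withDensity_eq_integral_toReal_smul
      (by fun_prop) (by simp)]
  have h1 : ∫ p in sphDomain, (ENNReal.ofReal (sin p.1)).toReal • f (sphPoint p.1 p.2) =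
      ∫ p in sphDomain, sin p.1 * f (sphPoint p.1 p.2) := by
    refine setIntegral_congr_fun measurableSet_sphDomain fun p hp => ?_
    rw [ENNReal.toReal_ofReal (sin_pos_of_mem_Ioo hp.1).le, smul_eq_mul]
  have h2 : (sphDomain : Set (ℝ × ℝ)) =ᵐ[volume] Ioc 0 π ×ˢ Ioc (-π) π := by
    rw [Measure.volume_eq_prod]
    exact Measure.set_prod_ae_eq Ioo_ae_eq_Ioc Ioo_ae_eq_Ioc
  rw [h1, setIntegral_congr_set h2, Measure.volume_eq_prod, setIntegral_prod]
  · rw [intervalIntegral.integral_of_le pi_pos.le]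
    refine setIntegral_congr_fun measurableSet_Ioc fun φ _ => ?_
    rw [intervalIntegral.integral_of_le (by linarith [pi_pos])]
    exact integral_const_mul (sin φ) fun t => f (sphPoint φ t)
  · rw [← Measure.volume_eq_prod]
    exact integrable_sin_mul

theorem toSphere_univ : (volume : Measure E3).toSphere univ = ENNReal.ofReal (4 * π) := by
  have h := integral_toSphere (ContinuousMap.const S2 1)
  simp only [ContinuousMap.const_apply, integral_const, smul_eq_mul, mul_one,
    intervalIntegral.integral_const, sub_neg_eq_add] at h
  rw [intervalIntegral.integral_mul_const, integral_sin, cos_zero, cos_pi] at h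
  rw [← ENNReal.ofReal_toReal (measure_ne_top (volume : Measure E3).toSphere univ)]
  congr 1
  rw [← measureReal_def, h]
  ring

/-- Integration against the normalized surface area measure in spherical coordinates. -/
theorem integral_sigma (f : C(S2, ℝ)) :
    ∫ x, f x ∂sigma =
      1 / (4 * π) * ∫ φ in (0)..π, sin φ * ∫ t in (-π)..π, f (sphPoint φ t) := by
  rw [sigma, integral_smul_measure, integral_toSphere, toSphere_univ, ENNReal.toReal_inv,
    ENNReal.toReal_ofReal (by positivity), smul_eq_mul, one_div]

end

end ZonalEqualArea

/-! ### Equidistribution. -/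

namespace ZonalEqualArea

noncomputable section

open Real MeasureTheory Set Filter Topology

/-- The midpoint rule for a `2π`-periodic function that varies little on each sector. -/
theorem abs_integral_sub_sum_le {g : ℝ → ℝ} (hg : Continuous g)
    (hper : Function.Periodic g (2 * π)) {n : ℕ} (hn : 0 < n) (θ₀ : ℝ) (v : ℕ → ℝ) {ε : ℝ}
    (h : ∀ k < n, ∀ t, |t - (θ₀ + (k + 1 / 2) * (2 * π / n))| ≤ π / n → |g t - v k| ≤ ε) :
    |(∫ t in (-π)..π, g t) - 2 * π / n * ∑ k ∈ Finset.range n, v k| ≤ 2 * π * ε := by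
  have hn0 : (n : ℝ) ≠ 0 := by positivity
  have hπ := pi_pos
  set w : ℝ := 2 * π / n with hw
  have hw0 : 0 < w := by positivity
  have hwn : n * w = 2 * π := by
    rw [hw]
    field_simp
  have hwh : π / n = w / 2 := by
    rw [hw]
    ring
  -- Periodicity lets the interval start at θ₀, so that its n equal pieces are the sectors of the
  -- cells.
  have h1 : ∫ t in (-π)..π, g t = ∫ t in θ₀..(θ₀ + 2 * π), g t := by
    rw [← hper.intervalIntegral_add_eq (-π) θ₀]
    congr 1
    ring
  have h2 : ∫ t in θ₀..(θ₀ + 2 * π), g t =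
      ∑ k ∈ Finset.range n, ∫ t in (θ₀ + k * w)..(θ₀ + (k + 1 : ℕ) * w), g t := by
    rw [intervalIntegral.sum_integral_adjacent_intervals (a := fun k : ℕ => θ₀ + k * w)
      fun k _ => hg.intervalIntegrable _ _]
    simp [hwn]
  rw [h1, h2, Finset.mul_sum, ← Finset.sum_sub_distrib]
  have h3 : ∀ k ∈ Finset.range n,
      |(∫ t in (θ₀ + k * w)..(θ₀ + (k + 1 : ℕ) * w), g t) - w * v k| ≤ w * ε := by
    intro k hk
    have h4 : w * v k = ∫ _ in (θ₀ + k * w)..(θ₀ + (k + 1 : ℕ) * w), v k := by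
      rw [intervalIntegral.integral_const, smul_eq_mul]
      push_cast
      ring
    rw [h4, ← intervalIntegral.integral_sub (hg.intervalIntegrable _ _) (by simp)]
    have h5 := intervalIntegral.norm_integral_le_of_norm_le_const
      (a := θ₀ + k * w) (b := θ₀ + (k + 1 : ℕ) * w) (f := fun t => g t - v k) (C := ε)
      fun t ht => by
        rw [uIoc_of_le (by push_cast; nlinarith)] at ht
        refine h k (Finset.mem_range.1 hk) t ?_
        have ht1 := ht.1
        have ht2 := ht.2
        push_cast at ht2
        rw [hwh, abs_le]
        constructor <;> nlinarith
    rw [Real.norm_eq_abs] at h5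
    refine h5.trans_eq ?_
    push_cast
    rw [show θ₀ + ((k : ℝ) + 1) * w - (θ₀ + k * w) = w by ring, abs_of_pos hw0, mul_comm]
  refine (Finset.abs_sum_le_sum_abs _ _).trans ((Finset.sum_le_sum h3).trans_eq ?_)
  rw [Finset.sum_const, Finset.card_range, nsmul_eq_mul, ← mul_assoc, hwn]

theorem continuous_sphPoint_snd (φ : ℝ) : Continuous (sphPoint φ) := by
  have h : Continuous ((fun p : ℝ × ℝ => sphPoint p.1 p.2) ∘ fun t => (φ, t)) :=
    continuous_sphPoint.comp (Continuous.prodMk_right φ)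
  exact h

theorem continuous_circleIntegral (f : C(S2, ℝ)) :
    Continuous fun φ => ∫ t in (-π)..π, f (sphPoint φ t) :=
  intervalIntegral.continuous_parametric_intervalIntegral_of_continuous'
    (f := fun φ t => f (sphPoint φ t)) (f.continuous.comp continuous_sphPoint) _ _

theorem numCells_pos' {N j : ℕ} (hN : 2 ≤ N) (hj : j ≤ numCollars N + 1) :
    0 < numCells N (j + 1) := by
  rcases Nat.eq_zero_or_pos j with rfl | h0
  · simp [numCells_one]
  rcases hj.eq_or_lt with rfl | h1
  · simp [numCells_last]
  · exact numCells_pos hN h0 (by omega)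

/-- The polar caps join as collars with a single cell, which makes the sum over collars uniform. -/
theorem dist_cellCenter_le' {N j k : ℕ} {θ : ℕ → ℝ} {φ t : ℝ} (hN : 4 ≤ N)
    (hj : j ≤ numCollars N + 1) (hφ : φ ∈ Icc (latitude N j) (latitude N (j + 1)))
    (ht : |t - (θ (j + 1) + (k + 1 / 2) * (2 * π / numCells N (j + 1)))| ≤
      π / numCells N (j + 1)) :
    dist (sphPoint φ t) (cellCenter N θ (j + 1) k) ≤ 3.5 * scale N := by
  have hN2 : 2 ≤ N := by omega
  have hs := scale_pos hN2
  rcases Nat.eq_zero_or_pos j with rfl | h0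
  · rw [latitude_zero, latitude_one hN2] at hφ
    rw [cellCenter_one]
    exact (dist_north_le hN2 hφ.1 hφ.2).trans (by linarith)
  rcases hj.eq_or_lt with rfl | h1
  · rw [latitude_last, latitude_numCollars_add_one hN2] at hφ
    rw [cellCenter_last]
    exact (dist_south_le hN2 hφ.2 hφ.1).trans (by linarith)
  · exact dist_cellCenter_le hN h0 (by omega) hφ ht

/-- On each circle of latitude the sum over the sectors approximates the integral within 2πε. As sin
φ integrates over the collar to 2 y_j/N, every cell receives the same weight 4π/N. -/
theorem abs_integral_collar_sub_le {N j : ℕ} (hN : 4 ≤ N) (θ : ℕ → ℝ) (f : C(S2, ℝ)) {ε : ℝ}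
    (hf : ∀ x y, dist x y ≤ 3.5 * scale N → |f x - f y| ≤ ε) (hj : j ≤ numCollars N + 1) :
    |(∫ φ in (latitude N j)..(latitude N (j + 1)), sin φ * ∫ t in (-π)..π, f (sphPoint φ t)) -
      4 * π / N * ∑ k ∈ Finset.range (numCells N (j + 1)), f (cellCenter N θ (j + 1) k)| ≤
      4 * π / N * ε * numCells N (j + 1) := by
  have hN2 : 2 ≤ N := by omega
  have hN0 : (N : ℝ) ≠ 0 := by positivity
  have hy := numCells_pos' hN2 hj
  have hy0 : (numCells N (j + 1) : ℝ) ≠ 0 := by positivity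
  have hle := latitude_le_succ hN2 (j := j) (by omega)
  have hc := cos_latitude_sub hN2 (j := j) (by omega)
  set S := ∑ k ∈ Finset.range (numCells N (j + 1)), f (cellCenter N θ (j + 1) k)
  have h1 : ∀ φ ∈ Icc (latitude N j) (latitude N (j + 1)),
      |(∫ t in (-π)..π, f (sphPoint φ t)) - 2 * π / numCells N (j + 1) * S| ≤ 2 * π * ε := by
    intro φ hφ
    refine abs_integral_sub_sum_le (f.continuous.comp (continuous_sphPoint_snd φ)) ?_ hy
      (θ (j + 1)) _ fun k _ t ht => hf _ _ (dist_cellCenter_le' hN hj hφ ht)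
    intro t
    have := sphPoint_add_two_pi_mul φ t 1
    rw [Int.cast_one, one_mul] at this
    rw [Function.comp_apply, Function.comp_apply, this]
  have h2 : 4 * π / N * S = ∫ φ in (latitude N j)..(latitude N (j + 1)),
      sin φ * (2 * π / numCells N (j + 1) * S) := by
    rw [intervalIntegral.integral_mul_const, integral_sin, hc]
    field_simp
    ring
  have hcont : Continuous fun φ => sin φ * ∫ t in (-π)..π, f (sphPoint φ t) :=
    continuous_sin.mul (continuous_circleIntegral f)
  have hcont' : Continuous fun φ => sin φ * (2 * π / numCells N (j + 1) * S) := by fun_prop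
  have hcont'' : Continuous fun φ => sin φ * (2 * π * ε) := by fun_prop
  rw [h2, ← intervalIntegral.integral_sub (hcont.intervalIntegrable _ _)
    (hcont'.intervalIntegrable _ _), ← Real.norm_eq_abs]
  refine (intervalIntegral.norm_integral_le_of_norm_le hle (g := fun φ => sin φ * (2 * π * ε))
    (ae_of_all _ fun φ hφ => ?_) (hcont''.intervalIntegrable _ _)).trans_eq ?_
  · have hs : 0 ≤ sin φ := sin_nonneg_of_nonneg_of_le_pi
      ((latitude_nonneg N j).trans hφ.1.le) (hφ.2.trans (latitude_le_pi N (j + 1)))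
    rw [← mul_sub, Real.norm_eq_abs, abs_mul, abs_of_nonneg hs]
    exact mul_le_mul_of_nonneg_left (h1 φ ⟨hφ.1.le, hφ.2⟩) hs
  · rw [intervalIntegral.integral_mul_const, integral_sin, hc]
    ring

theorem sum_range_numCells {N : ℕ} (hN : 2 ≤ N) :
    ∑ j ∈ Finset.range (numCollars N + 2), (numCells N (j + 1) : ℝ) = N := by
  have h := sum_numCells hN
  rw [← Finset.Ico_succ_right_eq_Icc, Finset.sum_Ico_eq_sum_range] at h
  simp only [Nat.succ_eq_succ, Nat.succ_eq_add_one, Nat.add_sub_cancel, add_comm 1] at h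
  exact_mod_cast h

theorem abs_sum_zonalConfig_sub_le {N : ℕ} (hN : 4 ≤ N) (θ : ℕ → ℝ) (f : C(S2, ℝ)) {ε : ℝ}
    (hf : ∀ x y, dist x y ≤ 3.5 * scale N → |f x - f y| ≤ ε) :
    |(N : ℝ)⁻¹ * ∑ x ∈ zonalConfig N θ, f x - ∫ x, f x ∂sigma| ≤ ε := by
  have hN2 : 2 ≤ N := by omega
  have hN0 : (0 : ℝ) < N := by positivity
  have hπ := pi_pos
  have hcont : Continuous fun φ => sin φ * ∫ t in (-π)..π, f (sphPoint φ t) :=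
    continuous_sin.mul (continuous_circleIntegral f)
  have h1 := intervalIntegral.sum_integral_adjacent_intervals (n := numCollars N + 2)
    (a := latitude N) (μ := volume) fun k _ => hcont.intervalIntegrable _ _
  rw [latitude_zero, latitude_last] at h1
  have h2 : ∑ x ∈ zonalConfig N θ, f x = ∑ j ∈ Finset.range (numCollars N + 2),
      ∑ k ∈ Finset.range (numCells N (j + 1)), f (cellCenter N θ (j + 1) k) := by
    rw [sum_zonalConfig hN2, ← Finset.Ico_succ_right_eq_Icc, Finset.sum_Ico_eq_sum_range]
    simp only [Nat.succ_eq_succ, Nat.succ_eq_add_one, Nat.add_sub_cancel, add_comm 1]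
  rw [integral_sigma, ← h1, h2, abs_sub_comm]
  have h3 : ∀ A B : ℝ, 1 / (4 * π) * A - (N : ℝ)⁻¹ * B = 1 / (4 * π) * (A - 4 * π / N * B) := by
    intro A B
    field_simp
  rw [h3, abs_mul, abs_of_pos (by positivity), Finset.mul_sum, ← Finset.sum_sub_distrib]
  have h4 : |∑ j ∈ Finset.range (numCollars N + 2),
      ((∫ φ in (latitude N j)..(latitude N (j + 1)), sin φ * ∫ t in (-π)..π, f (sphPoint φ t)) -
      4 * π / N * ∑ k ∈ Finset.range (numCells N (j + 1)), f (cellCenter N θ (j + 1) k))| ≤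
      4 * π / N * ε * N := by
    refine (Finset.abs_sum_le_sum_abs _ _).trans ((Finset.sum_le_sum fun j hj =>
      abs_integral_collar_sub_le hN θ f hf ?_).trans_eq ?_)
    · have := Finset.mem_range.1 hj
      omega
    · rw [← Finset.mul_sum, sum_range_numCells hN2]
  calc _ ≤ 1 / (4 * π) * (4 * π / N * ε * N) := by gcongr
    _ = ε := by field_simp

theorem integral_countingMeasure (N : ℕ) (ω : Finset S2) (f : C(S2, ℝ)) :
    ∫ x, f x ∂(countingMeasure N ω) = (N : ℝ)⁻¹ * ∑ x ∈ ω, f x := by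
  rw [countingMeasure, integral_smul_measure, integral_finsetSum_measure]
  · simp
  · intro x _
    exact integrable_dirac (by simp)

theorem tendsto_scale : Tendsto scale atTop (𝓝 0) :=
  tendsto_inv_atTop_zero.comp (tendsto_sqrt_atTop.comp tendsto_natCast_atTop_atTop)

theorem isEquidistributed_zonalConfig (θ : ℕ → ℕ → ℝ) :
    IsEquidistributed fun N => zonalConfig N (θ N) := by
  intro f
  simp only [integral_countingMeasure]
  have huc := CompactSpace.uniformContinuous_of_continuous f.continuous
  rw [Metric.tendsto_atTop']
  intro ε hε
  obtain ⟨δ, hδ, h⟩ := Metric.uniformContinuous_iff.1 huc (ε / 2) (half_pos hε)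
  obtain ⟨N₀, hN₀⟩ := eventually_atTop.1
    (tendsto_scale.eventually (gt_mem_nhds (by positivity : 0 < δ / 3.5)))
  refine ⟨max N₀ 4, fun N hN => ?_⟩
  have hN4 : 4 ≤ N := (le_max_right _ _).trans hN.le
  have hs := hN₀ N ((le_max_left _ _).trans hN.le)
  rw [lt_div_iff₀ (by norm_num)] at hs
  refine lt_of_le_of_lt (abs_sum_zonalConfig_sub_le hN4 (θ N) f fun x y hxy => ?_)
    (half_lt_self hε)
  exact (h (a := x) (b := y) (by linarith)).le

end

end ZonalEqualArea

theorem mainTheorem4 (θ : ℕ → ℕ → ℝ) :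
    (∀ N : ℕ, 2 ≤ N → (ZonalEqualArea.zonalConfig N (θ N)).card = N) ∧
    ZonalEqualArea.IsEquidistributed (fun N => ZonalEqualArea.zonalConfig N (θ N)) ∧
    ZonalEqualArea.IsQuasiUniform (fun N => ZonalEqualArea.zonalConfig N (θ N)) ∧
    ∀ N : ℕ, 2 ≤ N →
      ZonalEqualArea.coveringRadius (ZonalEqualArea.zonalConfig N (θ N)) ≤ 3.5 / Real.sqrt N := by
  refine ⟨fun N hN => ZonalEqualArea.card_zonalConfig hN (θ N),
    ZonalEqualArea.isEquidistributed_zonalConfig θ,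
    ⟨17.5, fun N hN => ZonalEqualArea.meshRatio_zonalConfig_le hN (θ N)⟩, fun N hN => ?_⟩
  rw [div_eq_mul_inv]
  exact ZonalEqualArea.coveringRadius_zonalConfig_le hN (θ N)
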